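/- Let $(X_t)_{t\in\mathbb Z}$ be a strictly stationary real-valued process. Assume * (Bound) $|X_0|\le\mathcal B$ almost surely, with $\mathcal B>0$; * (PhiMix) $1+\sum_{r\ge1}\sqrt{\phi_r}\le\mathcal C$, where $\phi_r=\sup|\mathbb P(F\mid A)-\mathbb P(F)|$ over all $A\in\sigma(X_t,t\le0)$ with $\mathbb P(A)>0$ and all $F\in\sigma(X_t,t\ge r)$. Let $1\le p\le k<n$ be integers (the case $k=p$ being the natural one) and $L>0$. For $\theta\in\mathbb R^p$ let $\hat X_t^\theta=\sum_{j=1}^p\theta_jX_{t-j}$, let $R(\theta)=\mathbb E[(\hat X_0^\theta-X_0)^2]$ be its quadratic prediction risk, and let $r_n(\theta)=\frac1{n-k}\sum_{i=k+1}^n(\hat X_i^\theta-X_i)^2$ be its empirical risk. Let $\Theta=\{\theta\in\mathbb R^p:\|\theta\|_1\le L\}$ and, for $J\subset\{1,\dots,p\}$, $\Theta_J=\{\theta\in\Theta:\theta_j\ne0\Leftrightarrow j\in J\}$. Let $\pi_J$ be the uniform probability measure on $\Theta_J$ (with respect to $|J|$-dimensional Lebesgue measure; $\pi_\emptyset=\delta_0$),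 let $p_J=2^{-|J|-1}\binom p{|J|}^{-1}$ and $\pi=\sum_Jp_J\pi_J$. For $\lambda>0$ the Gibbs estimator is $$\hat\theta_\lambda=\int\theta\,\hat\rho_\lambda(\mathrm d\theta),\qquad \hat\rho_\lambda(\mathrm d\theta)=\frac{e^{-\lambda r_n(\theta)}\,\pi(\mathrm d\theta)}{\int e^{-\lambda r_n(\theta')}\,\pi(\mathrm d\theta')}.$$ There is a constant $c_{\min}=c_{\min}(\mathcal B,\mathcal C,L)>0$ such that for every $c_0\ge c_{\min}$ there is a constant $\mathrm{cst}=\mathrm{cst}(c_0,\mathcal B,\mathcal C,L)>0$ (neither depends on $p,k,n$, on $\varepsilon$ or on the process) with the following property. Let $\lambda=\frac{n-k}{c_0k}$. If $R$ has a global minimizer over $\mathbb R^p$, $\overline\theta\in\arg\min_{\theta\in\mathbb R^p}R(\theta)$, that belongs to $\Theta$, then for every $\varepsilon>0$, with probability at least $1-\varepsilon$, $$R(\hat\theta_\lambda)\le R(\overline\theta)+4\inf_{J\subset\{1,\dots,p\}}\left\{\inf_{\theta\in\Theta_J}R(\theta)-R(\overline\theta)+\mathrm{cst}\cdot k\cdot\frac{|J|\log\left((n-k)p/|J|\right)+\log(2/\varepsilon)}{n-k}\right\},$$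 where $|J|\log((n-k)p/|J|)$ is read as $0$ for $J=\emptyset$. -/

import Mathlib

open MeasureTheory ProbabilityTheory

noncomputable section

namespace SparseAR

variable {Ω : Type*} [MeasurableSpace Ω]

/-- Strict stationarity of a process indexed by `ℤ`: all time shifts have the same law
on the path space `ℤ → ℝ`. -/
def IsStationary (μ : Measure Ω) (X : ℤ → Ω → ℝ) : Prop :=
  ∀ h : ℤ, IdentDistrib (fun ω (t : ℤ) => X (t + h) ω) (fun ω (t : ℤ) => X t ω) μ μ

/-- The σ-algebra `σ(X_t, t ≤ 0)`. -/
abbrev pastSigma (X : ℤ → Ω → ℝ) : MeasurableSpace Ω :=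
  ⨆ t ∈ Set.Iic (0 : ℤ), MeasurableSpace.comap (X t) inferInstance

/-- The σ-algebra `σ(X_t, t ≥ r)`. -/
abbrev futureSigma (X : ℤ → Ω → ℝ) (r : ℤ) : MeasurableSpace Ω :=
  ⨆ t ∈ Set.Ici r, MeasurableSpace.comap (X t) inferInstance

/-- The uniform mixing coefficient
`φ_r = sup |P(F | A) - P(F)|` over `A ∈ σ(X_t, t ≤ 0)` with `P(A) > 0` and
`F ∈ σ(X_t, t ≥ r)`. -/
def phiCoeff (μ : Measure Ω) (X : ℤ → Ω → ℝ) (r : ℕ) : ℝ :=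
  sSup {x : ℝ | ∃ A F : Set Ω, MeasurableSet[pastSigma X] A ∧
    MeasurableSet[futureSigma X r] F ∧ μ A ≠ 0 ∧ x = |(μ[|A]).real F - μ.real F|}

/-- `1 + ∑_{r ≥ 1} √φ_r ≤ C`, convergence of the series being part of the condition. -/
def PhiMix (μ : Measure Ω) (X : ℤ → Ω → ℝ) (C : ℝ) : Prop :=
  Summable (fun r : ℕ => √(phiCoeff μ X (r + 1))) ∧
    1 + ∑' r : ℕ, √(phiCoeff μ X (r + 1)) ≤ C

/-- `|X_0| ≤ B` almost surely. -/
def Bound (μ : Measure Ω) (X : ℤ → Ω → ℝ) (B : ℝ) : Prop :=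
  ∀ᵐ ω ∂μ, |X 0 ω| ≤ B

/-- The linear autoregressive prediction of `X_t`. The coordinate `j : Fin p`, counted from `0`,
is the coefficient of lag `j + 1`. -/
def predictor {p : ℕ} (X : ℤ → Ω → ℝ) (θ : Fin p → ℝ) (t : ℤ) (ω : Ω) : ℝ :=
  ∑ j : Fin p, θ j * X (t - ((j : ℤ) + 1)) ω

/-- The prediction risk for the quadratic loss; it is evaluated at time `0`, and for a stationary
process every other time gives the same value. -/
def risk {p : ℕ} (μ : Measure Ω) (X : ℤ → Ω → ℝ) (θ : Fin p → ℝ) : ℝ :=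
  ∫ ω, (predictor X θ 0 ω - X 0 ω) ^ 2 ∂μ

/-- The empirical risk `(n - k)⁻¹ ∑_{i = k+1}^n (prediction of X_i - X_i)²`. -/
def empRisk {p : ℕ} (X : ℤ → Ω → ℝ) (n k : ℕ) (θ : Fin p → ℝ) (ω : Ω) : ℝ :=
  ((n : ℝ) - k)⁻¹ * ∑ i ∈ Finset.Icc (k + 1) n, (predictor X θ (i : ℤ) ω - X (i : ℤ) ω) ^ 2

/-- The whole parameter set: the closed `ℓ¹` ball of radius `L` in `ℝ^p`. -/
def Theta (p : ℕ) (L : ℝ) : Set (Fin p → ℝ) :=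
  {θ | ∑ j, |θ j| ≤ L}

/-- The model `Θ_J`: parameters of the `ℓ¹` ball whose support is exactly `J`. -/
def ThetaJ (p : ℕ) (L : ℝ) (J : Finset (Fin p)) : Set (Fin p → ℝ) :=
  {θ | ∑ j, |θ j| ≤ L ∧ ∀ j, θ j ≠ 0 ↔ j ∈ J}

/-- Extension by zero `ℝ^J → ℝ^p`. -/
def extendZero {p : ℕ} (J : Finset (Fin p)) (v : J → ℝ) : Fin p → ℝ :=
  fun j => if h : j ∈ J then v ⟨j, h⟩ else 0

/-- The uniform probability measure on `Θ_J`, with respect to `|J|`-dimensional Lebesgue measure: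
Lebesgue measure on `ℝ^J` conditioned on the set of those `v` whose extension by zero lies in `Θ_J`,
transported to `ℝ^p`. For `J = ∅` it is the Dirac mass at `0`. -/
def priorJ (p : ℕ) (L : ℝ) (J : Finset (Fin p)) : Measure (Fin p → ℝ) :=
  ((volume : Measure (J → ℝ))[|extendZero J ⁻¹' ThetaJ p L J]).map (extendZero J)

/-- The weight `2^{-|J|-1} / binom(p, |J|)` of the model `Θ_J`. -/
def weight (p : ℕ) (J : Finset (Fin p)) : ℝ :=
  (2 : ℝ) ^ (-(J.card : ℤ) - 1) * ((p.choose J.card : ℝ))⁻¹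

/-- The prior `∑_J p_J π_J`. (The weights add up to `1 - 2^{-p-1}`; the Gibbs measure is normalised
and does not depend on the total mass.) -/
def prior (p : ℕ) (L : ℝ) : Measure (Fin p → ℝ) :=
  ∑ J : Finset (Fin p), ENNReal.ofReal (weight p J) • priorJ p L J

/-- The Gibbs measure, with density `e^{-lam r_n(θ)} / ∫ e^{-lam r_n} dπ` with respect to the
prior `π`. -/
def gibbsMeasure (p : ℕ) (L : ℝ) (X : ℤ → Ω → ℝ) (n k : ℕ) (lam : ℝ) (ω : Ω) :
    Measure (Fin p → ℝ) :=
  (prior p L).tilted (fun θ => -lam * empRisk X n k θ ω)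

/-- The Gibbs estimator: the mean of the Gibbs measure. -/
def gibbsEstimator (p : ℕ) (L : ℝ) (X : ℤ → Ω → ℝ) (n k : ℕ) (lam : ℝ) (ω : Ω) : Fin p → ℝ :=
  ∫ θ, θ ∂(gibbsMeasure p L X n k lam ω)

/-- The oracle risk `inf_{θ ∈ Θ_J} R(θ)` of the model `Θ_J`. (`Θ_J` is not closed, so the infimum
need not be attained.) -/
def oracleRisk {p : ℕ} (μ : Measure Ω) (X : ℤ → Ω → ℝ) (L : ℝ) (J : Finset (Fin p)) : ℝ :=
  ⨅ θ : ThetaJ p L J, risk μ X (θ : Fin p → ℝ)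

end SparseAR

end

/-!
Write `N = n - k`, `b = (1 + L) B`, `D θ = R θ - R θbar` and `Δ θ = r_n θ - r_n θbar`. The argument
is of PAC-Bayesian type and rests on an exponential inequality for the excess empirical risk.

*The exponential inequality.* A Hahn decomposition bounds the difference of the conditional and the
unconditional mean of a future observable `g` given the past by `√(2 φ)` times an `L²` norm of `g`
(`integral_weight_mul_sub_le_of_mixing`; the inequality is kept in linearised form, so that it
survives multiplication by weights from the past). Let `U 0, U 1, …` be centred variables bounded by
`τ` with variance at most `v`, and let `Γ` bound the sum of their dependence coefficients (square
roots of mixing coefficients). Under the law with density proportional to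
`exp (U 0 + ⋯ + U (i - 1))`, the second moment of every later `U m` is at most `2 v` as soon as
`19 τ Γ ≤ 1`: expand the density telescopically, apply the covariance inequality to each increment,
and induct on `i` (`WeaklyDependent.integral_expSum_mul_sq_le`). A second such expansion bounds the
mean of `U m` under that law by a multiple of `Γ v`, whence `E exp (∑ U i) ≤ exp (16 N Γ v)`
(`WeaklyDependent.integral_exp_sum_le`), a Bernstein-type inequality.

*The excess loss.* Windows of `p + 1` observations have coefficients with sum at most `k C`. Since
`θbar` minimises the risk over the whole space, its residual is orthogonal to all predictors, and
the second moment of the excess loss is at most `4 b² D θ`. With `lam = N / (c₀ k)` and `c₀` large,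
this gives `E exp (± lam (Δ θ - D θ)) ≤ exp (lam D θ / 2)` for every `θ` in the `ℓ¹` ball
(`integral_exp_empRisk_le`).

*From one parameter to the Gibbs estimator.* Integrating one direction over the prior, and using
Markov's inequality, with high probability `∫ exp (lam D / 2 - lam Δ) dπ ≤ 2 / ε`. As `D` is convex,
Jensen's inequality for the Gibbs measure turns this into a bound for `D` at the Gibbs estimator by
the partition function `∫ exp (-lam Δ) dπ` (`exp_mul_integral_le`). The latter is bounded
below by the contribution of the parameters of `Θ_J` within `ℓ¹` distance `2 L / N` of a nearly
optimal `θ₀ ∈ Θ_J` (`le_integral_exp_neg_empRisk`): their prior mass is at least `p_J N ^ (-|J|)` by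
homothety, `r_n` varies little there, and `Δ θ₀` is controlled by the other direction of the
exponential inequality. The optimal model is deterministic, so that no union bound over the models
is needed.

Truncating the process at `± B` changes neither the risks nor, almost surely, the estimator, and it
does not increase the mixing coefficients; so the process may be assumed to be bounded everywhere.
-/

namespace SparseAR

/-! ### Integral inequalities under uniform mixing -/

/-- Two measures that are `φ`-close on every event have integrals of `g` within `√(2 φ)` times an
`L²` norm of `g`, in the form linearised by a free parameter `a`: on either half of a Hahn
decomposition, `g ≤ a / 2 + g ^ 2 / (2 a)` is integrated against the difference of the measures. -/
theorem integral_sub_integral_le_of_abs_real_sub_le {Ω : Type*} [MeasurableSpace Ω]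
    {ν₁ ν₂ : Measure Ω} [IsFiniteMeasure ν₁] [IsFiniteMeasure ν₂] {φ : ℝ}
    (hφ : ∀ F, MeasurableSet F → |ν₁.real F - ν₂.real F| ≤ φ)
    {g : Ω → ℝ} (hg : Measurable g) {K : ℝ} (hK : ∀ ω, |g ω| ≤ K) {a : ℝ} (ha : 0 < a) :
    ∫ ω, g ω ∂ν₁ - ∫ ω, g ω ∂ν₂ ≤
      a * φ + (∫ ω, g ω ^ 2 ∂ν₁ + ∫ ω, g ω ^ 2 ∂ν₂) / (2 * a) := by
  have hK2 : ∀ ω, |g ω ^ 2| ≤ K ^ 2 := fun ω => by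
    rw [abs_pow]; exact pow_le_pow_left₀ (abs_nonneg _) (hK ω) 2
  have int1 : ∀ (ν : Measure Ω) [IsFiniteMeasure ν], Integrable g ν := fun ν _ =>
    Integrable.of_bound hg.aestronglyMeasurable K (.of_forall hK)
  have int2 : ∀ (ν : Measure Ω) [IsFiniteMeasure ν], Integrable (fun ω => g ω ^ 2) ν := fun ν _ =>
    Integrable.of_bound (hg.pow_const 2).aestronglyMeasurable (K ^ 2) (.of_forall hK2)
  obtain ⟨s, hs, h1, h2⟩ := hahn_decomposition ν₁ ν₂
  -- The common estimate on the part of the space where one measure dominates the other.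
  have key : ∀ (t : Set Ω) (ν ν' : Measure Ω) [IsFiniteMeasure ν] [IsFiniteMeasure ν'] (c : ℝ),
      c ^ 2 = 1 → MeasurableSet t → ν'.restrict t ≤ ν.restrict t → ν.real t - ν'.real t ≤ φ →
      c * (∫ ω in t, g ω ∂ν - ∫ ω in t, g ω ∂ν') ≤
        a / 2 * φ + (∫ ω in t, g ω ^ 2 ∂ν) / (2 * a) := by
    intro t ν ν' _ _ c hc ht hle hφt
    have hnn : ∀ ω, 0 ≤ a / 2 + g ω ^ 2 / (2 * a) - c * g ω := fun ω => by
      have : a / 2 + g ω ^ 2 / (2 * a) - c * g ω = (a - c * g ω) ^ 2 / (2 * a) := by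
        field_simp; linear_combination (-(g ω) ^ 2) * hc
      rw [this]; positivity
    have hint : ∀ (ρ : Measure Ω) [IsFiniteMeasure ρ],
        Integrable (fun ω => a / 2 + g ω ^ 2 / (2 * a) - c * g ω) ρ := fun ρ _ =>
      ((integrable_const _).add ((int2 ρ).div_const _)).sub ((int1 ρ).const_mul _)
    have hval : ∀ (ρ : Measure Ω) [IsFiniteMeasure ρ],
        ∫ ω in t, (a / 2 + g ω ^ 2 / (2 * a) - c * g ω) ∂ρ =
          a / 2 * ρ.real t + (∫ ω in t, g ω ^ 2 ∂ρ) / (2 * a) - c * ∫ ω in t, g ω ∂ρ := by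
      intro ρ _
      have i1 : Integrable (fun ω => a / 2 + g ω ^ 2 / (2 * a)) (ρ.restrict t) :=
        (integrable_const _).add ((int2 _).div_const _)
      rw [integral_sub i1 ((int1 _).const_mul _),
        integral_add (integrable_const _) ((int2 _).div_const _), integral_const_mul,
        integral_const, integral_div, measureReal_restrict_apply_univ, smul_eq_mul]
      ring
    have h := integral_mono_measure hle (.of_forall hnn) (hint _)
    rw [hval, hval] at h
    have h3 : 0 ≤ (∫ ω in t, g ω ^ 2 ∂ν') / (2 * a) :=
      div_nonneg (integral_nonneg fun ω => sq_nonneg _) (by positivity)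
    have h4 := mul_le_mul_of_nonneg_left hφt (by positivity : 0 ≤ a / 2)
    linarith
  have r1 : ν₂.restrict s ≤ ν₁.restrict s := Measure.le_iff.2 fun t ht => by
    rw [Measure.restrict_apply ht, Measure.restrict_apply ht]
    exact h1 _ (ht.inter hs) Set.inter_subset_right
  have r2 : ν₁.restrict sᶜ ≤ ν₂.restrict sᶜ := Measure.le_iff.2 fun t ht => by
    rw [Measure.restrict_apply ht, Measure.restrict_apply ht]
    exact h2 _ (ht.inter hs.compl) Set.inter_subset_right
  have k1 := key s ν₁ ν₂ 1 (by norm_num) hs r1 ((abs_le.1 (hφ s hs)).2)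
  have k2 := key sᶜ ν₂ ν₁ (-1) (by norm_num) hs.compl r2
    (by linarith [(abs_le.1 (hφ sᶜ hs.compl)).1])
  have e1 := integral_add_compl hs (int1 ν₁)
  have e2 := integral_add_compl hs (int1 ν₂)
  have e3 := integral_add_compl hs (int2 ν₁)
  have e4 := integral_add_compl hs (int2 ν₂)
  have p1 : 0 ≤ ∫ ω in sᶜ, g ω ^ 2 ∂ν₁ := integral_nonneg fun ω => sq_nonneg _
  have p2 : 0 ≤ ∫ ω in s, g ω ^ 2 ∂ν₂ := integral_nonneg fun ω => sq_nonneg _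
  have : (∫ ω in s, g ω ^ 2 ∂ν₁) / (2 * a) + (∫ ω in sᶜ, g ω ^ 2 ∂ν₂) / (2 * a) ≤
      (∫ ω, g ω ^ 2 ∂ν₁ + ∫ ω, g ω ^ 2 ∂ν₂) / (2 * a) := by
    rw [← add_div]
    exact div_le_div_of_nonneg_right (by linarith) (by positivity)
  linarith

/-- The preceding bound for the law conditioned on an event `A` of the past. -/
theorem setIntegral_sub_le_of_mixing {Ω : Type*} {m' mΩ : MeasurableSpace Ω}
    {μ : Measure Ω} [IsProbabilityMeasure μ] (hm' : m' ≤ mΩ) {φ : ℝ} {A : Set Ω}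
    (hA : MeasurableSet A)
    (hφ : ∀ F, MeasurableSet[m'] F → |μ.real (A ∩ F) - μ.real A * μ.real F| ≤ φ * μ.real A)
    {g : Ω → ℝ} (hg : Measurable[m'] g) {K : ℝ} (hK : ∀ ω, |g ω| ≤ K) {a : ℝ} (ha : 0 < a) :
    ∫ ω in A, g ω ∂μ - μ.real A * ∫ ω, g ω ∂μ ≤ a * φ * μ.real A +
      (∫ ω in A, g ω ^ 2 ∂μ + μ.real A * ∫ ω, g ω ^ 2 ∂μ) / (2 * a) := by
  rcases eq_or_ne (μ A) 0 with h0 | h0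
  · simp [Measure.restrict_eq_zero.2 h0, Measure.real, h0]
  have hpos : 0 < μ.real A := ENNReal.toReal_pos h0 (measure_ne_top _ _)
  have : IsProbabilityMeasure (μ[|A]) := cond_isProbabilityMeasure h0
  have h := @integral_sub_integral_le_of_abs_real_sub_le Ω m' ((μ[|A]).trim hm') (μ.trim hm')
    inferInstance inferInstance φ (by
      intro F hF
      rw [Measure.real, Measure.real, trim_measurableSet_eq hm' hF, trim_measurableSet_eq hm' hF,
        cond_apply hA, ENNReal.toReal_mul, ENNReal.toReal_inv, ← Measure.real, ← Measure.real,
        ← Measure.real]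
      have := hφ F hF
      have e : (μ.real A)⁻¹ * μ.real (A ∩ F) - μ.real F =
          (μ.real A)⁻¹ * (μ.real (A ∩ F) - μ.real A * μ.real F) := by
        field_simp
      rw [e, abs_mul, abs_of_pos (inv_pos.2 hpos), inv_mul_le_iff₀ hpos]
      linarith) g hg K hK a ha
  have c : ∀ f : Ω → ℝ, ∫ ω, f ω ∂(μ[|A]) = (μ.real A)⁻¹ * ∫ ω in A, f ω ∂μ := by
    intro f
    rw [ProbabilityTheory.cond, integral_smul_measure, ENNReal.toReal_inv]; rfl
  have hg' : @StronglyMeasurable _ _ _ m' g := hg.stronglyMeasurable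
  have hg2 : @StronglyMeasurable _ _ _ m' (fun ω => g ω ^ 2) := (hg.pow_const 2).stronglyMeasurable
  rw [← integral_trim hm' hg', ← integral_trim hm' hg', ← integral_trim hm' hg2,
    ← integral_trim hm' hg2, c, c] at h
  have h' := mul_le_mul_of_nonneg_left h hpos.le
  field_simp at h' ⊢
  linarith

/-- The preceding bound for the conditional expectation given the past. The parameter `a` is
quantified inside the almost sure statement, so that it may be chosen depending on `ω`. -/
theorem ae_condExp_sub_le_of_mixing {Ω : Type*} {m m' mΩ : MeasurableSpace Ω}
    {μ : Measure Ω} [IsProbabilityMeasure μ] (hm : m ≤ mΩ) (hm' : m' ≤ mΩ) {φ : ℝ}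
    (hφ : ∀ A F, MeasurableSet[m] A → MeasurableSet[m'] F →
      |μ.real (A ∩ F) - μ.real A * μ.real F| ≤ φ * μ.real A)
    {g : Ω → ℝ} (hg : Measurable[m'] g) {K : ℝ} (hK : ∀ ω, |g ω| ≤ K) :
    ∀ᵐ ω ∂μ, ∀ a : ℝ, 0 < a → (μ[g|m]) ω - ∫ ω, g ω ∂μ ≤
      a * φ + ((μ[fun ω => g ω ^ 2|m]) ω + ∫ ω, g ω ^ 2 ∂μ) / (2 * a) := by
  have hgm : Measurable g := hg.mono hm' le_rfl
  have hK2 : ∀ ω, |g ω ^ 2| ≤ K ^ 2 := fun ω => by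
    rw [abs_pow]; exact pow_le_pow_left₀ (abs_nonneg _) (hK ω) 2
  have int1 : Integrable g μ :=
    Integrable.of_bound hgm.aestronglyMeasurable K (.of_forall hK)
  have int2 : Integrable (fun ω => g ω ^ 2) μ :=
    Integrable.of_bound (hgm.pow_const 2).aestronglyMeasurable (K ^ 2) (.of_forall hK2)
  have hφ0 : 0 ≤ φ := by
    have := hφ Set.univ Set.univ (@MeasurableSet.univ _ m) (@MeasurableSet.univ _ m')
    simpa using this
  set c := μ[g|m]
  set d := μ[fun ω => g ω ^ 2|m]
  have hd : 0 ≤ᵐ[μ] d := condExp_nonneg (.of_forall fun ω => sq_nonneg _)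
  have hg20 : 0 ≤ ∫ ω, g ω ^ 2 ∂μ := integral_nonneg fun ω => sq_nonneg _
  have hq : ∀ a : ℝ, 0 < a → ∀ᵐ ω ∂μ, c ω - ∫ ω, g ω ∂μ ≤
      a * φ + (d ω + ∫ ω, g ω ^ 2 ∂μ) / (2 * a) := by
    intro a ha
    let f : Ω → ℝ := fun ω =>
      a * φ + (d ω + ∫ ω, g ω ^ 2 ∂μ) / (2 * a) - (c ω - ∫ ω, g ω ∂μ)
    have hd_int : Integrable d μ := integrable_condExp
    have hc_int : Integrable c μ := integrable_condExp
    have hint : Integrable f μ :=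
      ((integrable_const _).add ((hd_int.add (integrable_const _)).div_const _)).sub
        (hc_int.sub (integrable_const _))
    have hfm : @StronglyMeasurable _ _ _ m f := by
      have h1 : @StronglyMeasurable _ _ _ m c := stronglyMeasurable_condExp
      have h2 : @StronglyMeasurable _ _ _ m d := stronglyMeasurable_condExp
      have h3 : Measurable[m] f :=
        (measurable_const.add ((h2.measurable.add_const (∫ ω, g ω ^ 2 ∂μ)).div_const (2 * a))).sub
          (h1.measurable.sub_const (∫ ω, g ω ∂μ))
      exact h3.stronglyMeasurable
    have hpos : 0 ≤ᵐ[μ.trim hm] f := by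
      refine ae_nonneg_of_forall_setIntegral_nonneg (hint.trim hm hfm) fun s hs _ => ?_
      rw [← setIntegral_trim hm hfm hs]
      have h := setIntegral_sub_le_of_mixing hm' (hm s hs) (fun F hF => hφ s F hs hF) hg hK ha
      have i1 : ∫ ω in s, c ω ∂μ = ∫ ω in s, g ω ∂μ := setIntegral_condExp hm int1 hs
      have i2 : ∫ ω in s, d ω ∂μ = ∫ ω in s, g ω ^ 2 ∂μ := setIntegral_condExp hm int2 hs
      have : ∫ ω in s, f ω ∂μ = a * φ * μ.real s +
          (∫ ω in s, g ω ^ 2 ∂μ + μ.real s * ∫ ω, g ω ^ 2 ∂μ) / (2 * a) -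
          (∫ ω in s, g ω ∂μ - μ.real s * ∫ ω, g ω ∂μ) := by
        have hd' := hd_int.restrict (s := s)
        have hc' := hc_int.restrict (s := s)
        have i3 : Integrable (fun ω => (d ω + ∫ ω, g ω ^ 2 ∂μ) / (2 * a)) (μ.restrict s) :=
          (hd'.add (integrable_const _)).div_const _
        have i4 : Integrable (fun ω => a * φ + (d ω + ∫ ω, g ω ^ 2 ∂μ) / (2 * a))
            (μ.restrict s) := (integrable_const _).add i3
        have i5 : Integrable (fun ω => c ω - ∫ ω, g ω ∂μ) (μ.restrict s) :=
          hc'.sub (integrable_const _)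
        simp only [f]
        rw [integral_sub i4 i5, integral_add (integrable_const _) i3, integral_div,
          integral_add hd' (integrable_const _), integral_sub hc' (integrable_const _), i1, i2]
        simp [mul_comm]
      rw [this]; linarith
    filter_upwards [ae_le_of_ae_le_trim hpos] with ω hω
    simp only [f, Pi.zero_apply] at hω; linarith
  have hall : ∀ᵐ ω ∂μ, ∀ a : ℚ, 0 < (a : ℝ) → c ω - ∫ ω, g ω ∂μ ≤
      a * φ + (d ω + ∫ ω, g ω ^ 2 ∂μ) / (2 * a) := by
    rw [ae_all_iff]
    intro a
    by_cases ha : 0 < (a : ℝ)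
    · filter_upwards [hq a ha] with ω h _ using h
    · exact .of_forall fun ω h => absurd h ha
  filter_upwards [hall, hd] with ω hω hdω a ha
  simp only [Pi.zero_apply] at hdω
  refine le_of_forall_pos_le_add fun e he => ?_
  obtain ⟨b, hb1, hb2⟩ := exists_rat_btwn (show a < a + e / (φ + 1) by
    have : 0 < e / (φ + 1) := by positivity
    linarith)
  have h := hω b (ha.trans hb1)
  have h1 : (d ω + ∫ ω, g ω ^ 2 ∂μ) / (2 * b) ≤ (d ω + ∫ ω, g ω ^ 2 ∂μ) / (2 * a) := by gcongr
  have h2 : (b : ℝ) * φ ≤ a * φ + e := by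
    have : (b : ℝ) * φ ≤ (a + e / (φ + 1)) * φ := by gcongr
    have h3 : e / (φ + 1) * φ ≤ e := by
      rw [div_mul_eq_mul_div, div_le_iff₀ (by positivity)]; nlinarith
    linarith
  linarith

/-- The covariance inequality for uniform mixing with a nonnegative weight `W` from the past. The
factor `ψ` is the square root of the mixing coefficient, and the bound is in the linearised form of
the Cauchy-Schwarz inequality, `t` being the free parameter. -/
theorem integral_weight_mul_sub_le_of_mixing {Ω : Type*} {m m' mΩ : MeasurableSpace Ω}
    {μ : Measure Ω} [IsProbabilityMeasure μ] (hm : m ≤ mΩ) (hm' : m' ≤ mΩ) {ψ : ℝ}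
    (hψ : 0 ≤ ψ)
    (hφ : ∀ A F, MeasurableSet[m] A → MeasurableSet[m'] F →
      |μ.real (A ∩ F) - μ.real A * μ.real F| ≤ ψ ^ 2 * μ.real A)
    {W h g : Ω → ℝ} (hW : Measurable[m] W) (hW0 : ∀ ω, 0 ≤ W ω) {KW : ℝ} (hKW : ∀ ω, W ω ≤ KW)
    (hh : Measurable[m] h) {Kh : ℝ} (hKh : ∀ ω, |h ω| ≤ Kh)
    (hg : Measurable[m'] g) {K : ℝ} (hK : ∀ ω, |g ω| ≤ K) {t : ℝ} (ht : 0 < t) :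
    ∫ ω, W ω * (h ω * (g ω - ∫ ω, g ω ∂μ)) ∂μ ≤
      ψ * ∫ ω, W ω * (t * h ω ^ 2 + (g ω ^ 2 + ∫ ω, g ω ^ 2 ∂μ) / (2 * t)) ∂μ := by
  have hgm : Measurable g := hg.mono hm' le_rfl
  have hWm : Measurable W := hW.mono hm le_rfl
  have hhm : Measurable h := hh.mono hm le_rfl
  have hK2 : ∀ ω, |g ω ^ 2| ≤ K ^ 2 := fun ω => by
    rw [abs_pow]; exact pow_le_pow_left₀ (abs_nonneg _) (hK ω) 2
  have hWK : ∀ ω, |W ω| ≤ KW := fun ω => by rw [abs_of_nonneg (hW0 ω)]; exact hKW ω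
  have hWhK : ∀ ω, |W ω * h ω| ≤ KW * Kh := fun ω => by
    rw [abs_mul]; exact mul_le_mul (hWK ω) (hKh ω) (abs_nonneg _) ((abs_nonneg _).trans (hWK ω))
  have hWh2K : ∀ ω, |W ω * h ω ^ 2| ≤ KW * Kh ^ 2 := fun ω => by
    rw [abs_mul, abs_pow]
    exact mul_le_mul (hWK ω) (pow_le_pow_left₀ (abs_nonneg _) (hKh ω) 2) (by positivity)
      ((abs_nonneg _).trans (hWK ω))
  have int1 : Integrable g μ :=
    Integrable.of_bound hgm.aestronglyMeasurable K (.of_forall hK)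
  have int2 : Integrable (fun ω => g ω ^ 2) μ :=
    Integrable.of_bound (hgm.pow_const 2).aestronglyMeasurable (K ^ 2) (.of_forall hK2)
  set E₁ := ∫ ω, g ω ∂μ
  set E₂ := ∫ ω, g ω ^ 2 ∂μ
  set c := μ[g|m]
  set d := μ[fun ω => g ω ^ 2|m]
  have iW : Integrable W μ := Integrable.of_bound hWm.aestronglyMeasurable KW (.of_forall hWK)
  have iWh : Integrable (fun ω => W ω * h ω) μ :=
    Integrable.of_bound (hWm.mul hhm).aestronglyMeasurable _ (.of_forall hWhK)
  have iWh2 : Integrable (fun ω => W ω * h ω ^ 2) μ :=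
    Integrable.of_bound (hWm.mul (hhm.pow_const 2)).aestronglyMeasurable _ (.of_forall hWh2K)
  have pull : ∀ (V G : Ω → ℝ) (KV : ℝ), Measurable[m] V → (∀ ω, |V ω| ≤ KV) → Integrable G μ →
      Integrable (fun ω => V ω * G ω) μ ∧ Integrable (fun ω => V ω * (μ[G|m]) ω) μ ∧
      ∫ ω, V ω * G ω ∂μ = ∫ ω, V ω * (μ[G|m]) ω ∂μ := by
    intro V G KV hV hKV hG
    have hVm : Measurable V := hV.mono hm le_rfl
    refine ⟨hG.bdd_mul hVm.aestronglyMeasurable (.of_forall hKV),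
      integrable_condExp.bdd_mul hVm.aestronglyMeasurable (.of_forall hKV), ?_⟩
    have := condExp_stronglyMeasurable_mul_of_bound hm
      hV.stronglyMeasurable hG KV (.of_forall hKV)
    rw [← integral_condExp hm (f := fun ω => V ω * G ω)]
    exact integral_congr_ae this
  obtain ⟨a1, a2, a3⟩ := pull (fun ω => W ω * h ω) g _ (hW.mul hh) hWhK int1
  obtain ⟨b1, b2, b3⟩ := pull W (fun ω => g ω ^ 2) _ hW hWK int2
  have lhs : ∫ ω, W ω * (h ω * (g ω - E₁)) ∂μ = ∫ ω, W ω * h ω * (c ω - E₁) ∂μ := by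
    have e1 : ∀ ω, W ω * (h ω * (g ω - E₁)) = W ω * h ω * g ω - W ω * h ω * E₁ := fun ω => by ring
    have e2 : ∀ ω, W ω * h ω * (c ω - E₁) = W ω * h ω * c ω - W ω * h ω * E₁ := fun ω => by ring
    simp_rw [e1, e2]
    rw [integral_sub a1 (iWh.mul_const _), integral_sub a2 (iWh.mul_const _), a3]
  have rhs : ∫ ω, W ω * (t * h ω ^ 2 + (g ω ^ 2 + E₂) / (2 * t)) ∂μ =
      ∫ ω, W ω * (t * h ω ^ 2 + (d ω + E₂) / (2 * t)) ∂μ := by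
    have e : ∀ (G : Ω → ℝ) ω, W ω * (t * h ω ^ 2 + (G ω + E₂) / (2 * t)) =
        (t * (W ω * h ω ^ 2) + W ω * (E₂ / (2 * t))) + W ω * G ω / (2 * t) := fun G ω => by ring
    have i3 : Integrable (fun ω => t * (W ω * h ω ^ 2) + W ω * (E₂ / (2 * t))) μ :=
      (iWh2.const_mul t).add (iW.mul_const _)
    rw [integral_congr_ae (.of_forall (e fun ω => g ω ^ 2)), integral_congr_ae (.of_forall (e d)),
      integral_add i3 (b1.div_const _), integral_add i3 (b2.div_const _), integral_div,
      integral_div, b3]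
  rw [lhs, rhs]
  have main1 := ae_condExp_sub_le_of_mixing hm hm' hφ hg hK
  have main2 := ae_condExp_sub_le_of_mixing hm hm' hφ (g := fun ω => -g ω) hg.neg (K := K)
    (fun ω => by rw [abs_neg]; exact hK ω)
  have hneg : μ[fun ω => -g ω|m] =ᵐ[μ] fun ω => -c ω := condExp_neg g m
  have hd : 0 ≤ᵐ[μ] d := condExp_nonneg (.of_forall fun ω => sq_nonneg _)
  have hE₂ : 0 ≤ E₂ := integral_nonneg fun ω => sq_nonneg _
  rw [← integral_const_mul]
  have ir : Integrable (fun ω => W ω * (t * h ω ^ 2 + (d ω + E₂) / (2 * t))) μ := by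
    refine (((iWh2.const_mul t).add (iW.mul_const (E₂ / (2 * t)))).add
      (b2.div_const (2 * t))).congr (.of_forall fun ω => ?_)
    simp only [Pi.add_apply, d]; ring
  have il : Integrable (fun ω => W ω * h ω * (c ω - E₁)) μ := by
    refine (a2.sub (iWh.mul_const E₁)).congr (.of_forall fun ω => ?_)
    simp only [Pi.sub_apply, c]; ring
  refine integral_mono_ae il (ir.const_mul ψ) ?_
  filter_upwards [main1, main2, hneg, hd] with ω h1 h2 h3 h4
  simp only [neg_sq, integral_neg, Pi.zero_apply] at h2 h4
  rw [h3] at h2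
  -- For fixed `ω` the optimal parameter is proportional to `|h ω| / ψ`.
  have habs : ∀ a : ℝ, 0 < a → |c ω - E₁| ≤ a * ψ ^ 2 + (d ω + E₂) / (2 * a) := fun a ha =>
    abs_le'.2 ⟨h1 a ha, by have := h2 a ha; linarith⟩
  have hq : 0 ≤ d ω + E₂ := by linarith
  have hfin : |h ω| * |c ω - E₁| ≤ ψ * (t * h ω ^ 2 + (d ω + E₂) / (2 * t)) := by
    rcases (abs_nonneg (h ω)).eq_or_lt with h0 | h0
    · rw [← h0, zero_mul]; positivity
    rcases hψ.eq_or_lt with p0 | p0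
    · -- With a vanishing coefficient the parameter can be taken arbitrarily large.
      have : |c ω - E₁| ≤ 0 := by
        refine le_of_forall_pos_le_add fun e he => ?_
        have := habs ((d ω + E₂ + 1) / (2 * e)) (by positivity)
        rw [← p0] at this
        refine this.trans ?_
        have hx : (d ω + E₂) / (2 * ((d ω + E₂ + 1) / (2 * e))) ≤ e := by
          rw [div_le_iff₀ (by positivity)]; field_simp; linarith
        linarith
      rw [← p0, zero_mul]
      exact mul_nonpos_of_nonneg_of_nonpos h0.le this
    · have := habs (|h ω| * t / ψ) (by positivity)
      have h5 := mul_le_mul_of_nonneg_left this h0.le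
      refine h5.trans (le_of_eq ?_)
      rw [← sq_abs (h ω)]
      field_simp
  calc W ω * h ω * (c ω - E₁) = W ω * (h ω * (c ω - E₁)) := by ring
    _ ≤ W ω * (|h ω| * |c ω - E₁|) := by
        refine mul_le_mul_of_nonneg_left ?_ (hW0 ω)
        rw [← abs_mul]; exact le_abs_self _
    _ ≤ W ω * (ψ * (t * h ω ^ 2 + (d ω + E₂) / (2 * t))) :=
        mul_le_mul_of_nonneg_left hfin (hW0 ω)
    _ = _ := by ring

/-- Without any mixing, the covariance inequality holds with coefficient one. -/
theorem integral_weight_mul_sub_le {Ω : Type*} {mΩ : MeasurableSpace Ω}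
    {μ : Measure Ω} [IsProbabilityMeasure μ]
    {W h g : Ω → ℝ} (hW : Measurable W) (hW0 : ∀ ω, 0 ≤ W ω) {KW : ℝ} (hKW : ∀ ω, W ω ≤ KW)
    (hh : Measurable h) {Kh : ℝ} (hKh : ∀ ω, |h ω| ≤ Kh)
    (hg : Measurable g) {K : ℝ} (hK : ∀ ω, |g ω| ≤ K) {t : ℝ} (ht : 0 < t) :
    ∫ ω, W ω * (h ω * (g ω - ∫ ω, g ω ∂μ)) ∂μ ≤
      1 * ∫ ω, W ω * (t * h ω ^ 2 + (g ω ^ 2 + ∫ ω, g ω ^ 2 ∂μ) / (2 * t)) ∂μ := by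
  have hK2 : ∀ ω, |g ω ^ 2| ≤ K ^ 2 := fun ω => by
    rw [abs_pow]; exact pow_le_pow_left₀ (abs_nonneg _) (hK ω) 2
  have hh2 : ∀ ω, |h ω ^ 2| ≤ Kh ^ 2 := fun ω => by
    rw [abs_pow]; exact pow_le_pow_left₀ (abs_nonneg _) (hKh ω) 2
  have hWK : ∀ ω, |W ω| ≤ KW := fun ω => by rw [abs_of_nonneg (hW0 ω)]; exact hKW ω
  have i1 : Integrable g μ := Integrable.of_bound hg.aestronglyMeasurable K (.of_forall hK)
  have i2 : Integrable (fun ω => g ω ^ 2) μ :=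
    Integrable.of_bound (hg.pow_const 2).aestronglyMeasurable (K ^ 2) (.of_forall hK2)
  have i3 : Integrable (fun ω => h ω ^ 2) μ :=
    Integrable.of_bound (hh.pow_const 2).aestronglyMeasurable (Kh ^ 2) (.of_forall hh2)
  have hvar : (∫ ω, g ω ∂μ) ^ 2 ≤ ∫ ω, g ω ^ 2 ∂μ := by
    have h0 : 0 ≤ ∫ ω, (g ω - ∫ ω, g ω ∂μ) ^ 2 ∂μ := integral_nonneg fun ω => sq_nonneg _
    have e : ∀ ω, (g ω - ∫ ω, g ω ∂μ) ^ 2 =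
        g ω ^ 2 - (2 * (∫ ω, g ω ∂μ) * g ω - (∫ ω, g ω ∂μ) ^ 2) := fun ω => by ring
    simp_rw [e] at h0
    have i4 : Integrable (fun ω => 2 * (∫ ω, g ω ∂μ) * g ω - (∫ ω, g ω ∂μ) ^ 2) μ :=
      (i1.const_mul _).sub (integrable_const _)
    rw [integral_sub i2 i4,
      integral_sub (i1.const_mul _) (integrable_const _), integral_const_mul] at h0
    simp at h0
    nlinarith
  rw [one_mul]
  refine integral_mono (Integrable.bdd_mul ?_ hW.aestronglyMeasurable (.of_forall hWK))
    (Integrable.bdd_mul ?_ hW.aestronglyMeasurable (.of_forall hWK)) fun ω => ?_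
  · exact (i1.sub (integrable_const _)).bdd_mul hh.aestronglyMeasurable (.of_forall hKh)
  · exact (i3.const_mul t).add ((i2.add (integrable_const _)).div_const _)
  refine mul_le_mul_of_nonneg_left ?_ (hW0 ω)
  set E := ∫ ω, g ω ∂μ
  have h1 : h ω * (g ω - E) ≤ t * h ω ^ 2 + (g ω - E) ^ 2 / (4 * t) := by
    have : t * h ω ^ 2 + (g ω - E) ^ 2 / (4 * t) - h ω * (g ω - E) =
        (2 * t * h ω - (g ω - E)) ^ 2 / (4 * t) := by field_simp; ring
    have h2 : 0 ≤ (2 * t * h ω - (g ω - E)) ^ 2 / (4 * t) := by positivity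
    linarith
  have h2 : (g ω - E) ^ 2 / (4 * t) ≤ (g ω ^ 2 + ∫ ω, g ω ^ 2 ∂μ) / (2 * t) := by
    rw [div_le_div_iff₀ (by positivity) (by positivity)]
    have : (g ω - E) ^ 2 ≤ 2 * (g ω ^ 2 + ∫ ω, g ω ^ 2 ∂μ) := by nlinarith [sq_nonneg (g ω + E)]
    nlinarith
  linarith

/-! ### An exponential inequality for weakly dependent sequences -/

theorem abs_exp_sub_one_sq_le {x τ : ℝ} (hx : |x| ≤ τ) (hτ : τ ≤ 1) :
    (Real.exp x - 1) ^ 2 ≤ 4 * x ^ 2 := by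
  have h := Real.abs_exp_sub_one_le (hx.trans hτ)
  rw [← sq_abs (Real.exp x - 1), ← sq_abs x]
  nlinarith [abs_nonneg (Real.exp x - 1), abs_nonneg x]

/-- Bounded centred variables `U i`, adapted to a filtration and satisfying the covariance
inequality with coefficients `ψ` depending on the gap, with `∑ ψ ≤ Γ`. Here `τ` bounds the
variables and `v` their variances. -/
structure WeaklyDependent {Ω : Type*} {mΩ : MeasurableSpace Ω} (μ : Measure Ω) (U : ℕ → Ω → ℝ)
    (G : ℕ → MeasurableSpace Ω) (ψ : ℕ → ℝ) (τ v Γ : ℝ) : Prop where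
  mono : Monotone G
  le : ∀ i, G i ≤ mΩ
  adapted : ∀ i, Measurable[G (i + 1)] (U i)
  bound : ∀ i ω, |U i ω| ≤ τ
  centred : ∀ i, ∫ ω, U i ω ∂μ = 0
  variance_le : ∀ i, ∫ ω, U i ω ^ 2 ∂μ ≤ v
  coeff_nonneg : ∀ r, 0 ≤ ψ r
  sum_coeff_le : ∀ n, ∑ r ∈ Finset.range n, ψ r ≤ Γ
  mixing : ∀ i m, i ≤ m → ∀ W h : Ω → ℝ, Measurable[G i] W → (∀ ω, 0 ≤ W ω) →
    ∀ KW : ℝ, (∀ ω, W ω ≤ KW) → Measurable[G i] h → ∀ Kh : ℝ, (∀ ω, |h ω| ≤ Kh) →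
    ∀ (e : ℕ) (t : ℝ), 0 < t →
    ∫ ω, W ω * (h ω * (U m ω ^ e - ∫ ω, U m ω ^ e ∂μ)) ∂μ ≤
      ψ (m - i) *
        ∫ ω, W ω * (t * h ω ^ 2 + ((U m ω ^ e) ^ 2 + ∫ ω, (U m ω ^ e) ^ 2 ∂μ) / (2 * t)) ∂μ

namespace WeaklyDependent

variable {Ω : Type*} {mΩ : MeasurableSpace Ω} {μ : Measure Ω}
  {U : ℕ → Ω → ℝ} {G : ℕ → MeasurableSpace Ω} {ψ : ℕ → ℝ} {τ v Γ : ℝ}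

/-- The exponential weight `exp (U 0 + ⋯ + U (i - 1))`. -/
noncomputable def expSum (U : ℕ → Ω → ℝ) (i : ℕ) (ω : Ω) : ℝ :=
  Real.exp (∑ l ∈ Finset.range i, U l ω)

theorem measurable (H : WeaklyDependent μ U G ψ τ v Γ) (i : ℕ) : Measurable (U i) :=
  (H.adapted i).mono (H.le _) le_rfl

theorem measurable_expSum (H : WeaklyDependent μ U G ψ τ v Γ) (i : ℕ) :
    Measurable[G i] (expSum U i) := by
  have : Measurable[G i] (fun ω => ∑ l ∈ Finset.range i, U l ω) :=
    Finset.measurable_sum _ fun l hl =>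
      (H.adapted l).mono (H.mono (Nat.succ_le_of_lt (Finset.mem_range.1 hl))) le_rfl
  exact Real.measurable_exp.comp this

theorem expSum_le (H : WeaklyDependent μ U G ψ τ v Γ) (i : ℕ) (ω : Ω) :
    expSum U i ω ≤ Real.exp (i * τ) := by
  refine Real.exp_le_exp.2 ?_
  calc ∑ l ∈ Finset.range i, U l ω ≤ ∑ _l ∈ Finset.range i, τ :=
        Finset.sum_le_sum fun l _ => (le_abs_self _).trans (H.bound l ω)
    _ = i * τ := by simp

theorem abs_pow_le (H : WeaklyDependent μ U G ψ τ v Γ) (m e : ℕ) (ω : Ω) :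
    |U m ω ^ e| ≤ τ ^ e := by
  rw [abs_pow]; exact pow_le_pow_left₀ (abs_nonneg _) (H.bound m ω) e

theorem abs_exp_sub_one_le (H : WeaklyDependent μ U G ψ τ v Γ) (j : ℕ) (ω : Ω) :
    |Real.exp (U j ω) - 1| ≤ Real.exp τ + 1 := by
  have h1 : Real.exp (U j ω) ≤ Real.exp τ :=
    Real.exp_le_exp.2 ((le_abs_self _).trans (H.bound j ω))
  rw [abs_le]; constructor <;> linarith [Real.exp_pos (U j ω), Real.exp_pos τ]

theorem sum_coeff_sub_le (H : WeaklyDependent μ U G ψ τ v Γ) {i m : ℕ} (him : i ≤ m) :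
    ∑ j ∈ Finset.range i, ψ (m - (j + 1)) ≤ Γ := by
  calc ∑ j ∈ Finset.range i, ψ (m - (j + 1)) ≤ ∑ j ∈ Finset.range m, ψ (m - (j + 1)) :=
        Finset.sum_le_sum_of_subset_of_nonneg (Finset.range_subset_range.2 him)
          fun _ _ _ => H.coeff_nonneg _
    _ = ∑ r ∈ Finset.range m, ψ r := by
        rw [← Finset.sum_range_reflect ψ]
        exact Finset.sum_congr rfl fun j _ => by rw [Nat.sub_sub, add_comm 1 j]
    _ ≤ Γ := H.sum_coeff_le m

variable [IsProbabilityMeasure μ]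

theorem integrable_expSum_mul (H : WeaklyDependent μ U G ψ τ v Γ) (i : ℕ) {f : Ω → ℝ}
    (hf : Measurable f) {K : ℝ} (hK : ∀ ω, |f ω| ≤ K) :
    Integrable (fun ω => expSum U i ω * f ω) μ := by
  refine Integrable.bdd_mul (Integrable.of_bound hf.aestronglyMeasurable K (.of_forall hK))
    ((H.measurable_expSum i).mono (H.le i) le_rfl).aestronglyMeasurable
    (c := Real.exp (i * τ)) (.of_forall fun ω => ?_)
  rw [Real.norm_eq_abs, expSum, Real.abs_exp]
  exact H.expSum_le i ω

theorem integrable_expSum (H : WeaklyDependent μ U G ψ τ v Γ) (i : ℕ) :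
    Integrable (expSum U i) μ := by
  simpa using H.integrable_expSum_mul i (f := fun _ => 1) measurable_const (K := 1) (by simp)

theorem integral_expSum_pos (H : WeaklyDependent μ U G ψ τ v Γ) (i : ℕ) :
    0 < ∫ ω, expSum U i ω ∂μ :=
  integral_exp_pos (H.integrable_expSum i)

/-- Telescoping of a covariance with the exponential weight over its factors. -/
theorem integral_expSum_mul_sub (H : WeaklyDependent μ U G ψ τ v Γ) {g : Ω → ℝ}
    (hg : Measurable g) {K : ℝ} (hK : ∀ ω, |g ω| ≤ K) (i : ℕ) :
    ∫ ω, expSum U i ω * (g ω - ∫ ω, g ω ∂μ) ∂μ = ∑ j ∈ Finset.range i,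
      ∫ ω, expSum U j ω * ((Real.exp (U j ω) - 1) * (g ω - ∫ ω, g ω ∂μ)) ∂μ := by
  have hgc : ∀ ω, |g ω - ∫ ω, g ω ∂μ| ≤ K + |∫ ω, g ω ∂μ| := fun ω =>
    (abs_sub _ _).trans (add_le_add_left (hK ω) _)
  induction i with
  | zero =>
    have hint : Integrable g μ := Integrable.of_bound hg.aestronglyMeasurable K (.of_forall hK)
    simp only [expSum, Finset.range_zero, Finset.sum_empty, Real.exp_zero, one_mul]
    rw [integral_sub hint (integrable_const _)]
    simp
  | succ i ih =>
    have hm : Measurable fun ω => (Real.exp (U i ω) - 1) * (g ω - ∫ ω, g ω ∂μ) :=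
      ((Real.measurable_exp.comp (H.measurable i)).sub_const _).mul (hg.sub_const _)
    have hb : ∀ ω, |(Real.exp (U i ω) - 1) * (g ω - ∫ ω, g ω ∂μ)| ≤
        (Real.exp τ + 1) * (K + |∫ ω, g ω ∂μ|) := fun ω => by
      rw [abs_mul]
      exact mul_le_mul (H.abs_exp_sub_one_le i ω) (hgc ω) (abs_nonneg _) (by positivity)
    rw [Finset.sum_range_succ, ← ih, ← integral_add
      (H.integrable_expSum_mul i (hg.sub_const _) hgc) (H.integrable_expSum_mul i hm hb)]
    refine integral_congr_ae (.of_forall fun ω => ?_)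
    simp only [expSum, Finset.sum_range_succ, Real.exp_add]
    ring

/-- The covariance of the exponential weight with a power of a later variable, given control of
the second moments under the earlier exponential weights. -/
theorem integral_expSum_mul_pow_sub_le (H : WeaklyDependent μ U G ψ τ v Γ) (hτ1 : τ ≤ 1)
    {i m e : ℕ} (him : i ≤ m) {q t : ℝ} (ht : 0 < t)
    (hA : ∀ j < i, ∫ ω, expSum U j ω ∂μ ≤ 2 * ∫ ω, expSum U i ω ∂μ)
    (hv : ∀ j < i, ∫ ω, expSum U j ω * U j ω ^ 2 ∂μ ≤ 2 * v * ∫ ω, expSum U j ω ∂μ)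
    (hq : ∀ j < i, ∫ ω, expSum U j ω * (U m ω ^ e) ^ 2 ∂μ ≤ 2 * q * ∫ ω, expSum U j ω ∂μ)
    (hq' : ∫ ω, (U m ω ^ e) ^ 2 ∂μ ≤ q) :
    ∫ ω, expSum U i ω * (U m ω ^ e - ∫ ω, U m ω ^ e ∂μ) ∂μ ≤
      Γ * ((8 * t * v + 3 * q / (2 * t)) * (2 * ∫ ω, expSum U i ω ∂μ)) := by
  have hv0 : 0 ≤ v := (integral_nonneg fun ω => sq_nonneg _).trans (H.variance_le 0)
  have hq0 : 0 ≤ q := (integral_nonneg fun ω => sq_nonneg _).trans hq'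
  rw [H.integral_expSum_mul_sub ((H.measurable m).pow_const e) (H.abs_pow_le m e)]
  have hApos := H.integral_expSum_pos i
  calc _ ≤ ∑ j ∈ Finset.range i, ψ (m - (j + 1)) *
        ((8 * t * v + 3 * q / (2 * t)) * (2 * ∫ ω, expSum U i ω ∂μ)) := ?_
    _ = (∑ j ∈ Finset.range i, ψ (m - (j + 1))) *
        ((8 * t * v + 3 * q / (2 * t)) * (2 * ∫ ω, expSum U i ω ∂μ)) := by rw [Finset.sum_mul]
    _ ≤ _ := mul_le_mul_of_nonneg_right (H.sum_coeff_sub_le him) (by positivity)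
  refine Finset.sum_le_sum fun j hj => ?_
  have hj := Finset.mem_range.1 hj
  refine (H.mixing (j + 1) m (by omega) (expSum U j) (fun ω => Real.exp (U j ω) - 1)
    ((H.measurable_expSum j).mono (H.mono (Nat.le_succ j)) le_rfl)
    (fun ω => (Real.exp_pos _).le) _ (H.expSum_le j)
    ((Real.measurable_exp.comp (H.adapted j)).sub_const 1) _ (H.abs_exp_sub_one_le j)
      e t ht).trans ?_
  refine mul_le_mul_of_nonneg_left ?_ (H.coeff_nonneg _)
  set E := ∫ ω, (U m ω ^ e) ^ 2 ∂μ
  have hUj : ∀ ω, |U j ω ^ 2| ≤ τ ^ 2 := H.abs_pow_le j 2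
  have hUm : ∀ ω, |(U m ω ^ e) ^ 2| ≤ (τ ^ e) ^ 2 := fun ω => by
    rw [abs_pow]; exact pow_le_pow_left₀ (abs_nonneg _) (H.abs_pow_le m e ω) 2
  have i1 := (H.integrable_expSum_mul j ((H.measurable j).pow_const 2) hUj).const_mul (4 * t)
  have i2 := (H.integrable_expSum_mul j (((H.measurable m).pow_const e).pow_const 2) hUm).div_const
    (2 * t)
  have i3 := (H.integrable_expSum j).mul_const (E / (2 * t))
  have i12 : Integrable (fun ω => 4 * t * (expSum U j ω * U j ω ^ 2) +
      expSum U j ω * (U m ω ^ e) ^ 2 / (2 * t)) μ := i1.add i2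
  calc ∫ ω, expSum U j ω * (t * (Real.exp (U j ω) - 1) ^ 2 + ((U m ω ^ e) ^ 2 + E) / (2 * t)) ∂μ
      ≤ ∫ ω, (4 * t * (expSum U j ω * U j ω ^ 2) +
          expSum U j ω * (U m ω ^ e) ^ 2 / (2 * t) + expSum U j ω * (E / (2 * t))) ∂μ := by
        refine integral_mono_of_nonneg (.of_forall fun ω => ?_) (i12.add i3)
          (.of_forall fun ω => ?_)
        · have : 0 ≤ E := integral_nonneg fun ω => sq_nonneg _
          have := (Real.exp_pos (∑ l ∈ Finset.range j, U l ω)).le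
          simp only [expSum, Pi.zero_apply]; positivity
        · have h1 := abs_exp_sub_one_sq_le (H.bound j ω) hτ1
          have h2 := mul_le_mul_of_nonneg_left (mul_le_mul_of_nonneg_left h1 ht.le)
            (Real.exp_pos (∑ l ∈ Finset.range j, U l ω)).le
          simp only [expSum]
          rw [mul_add, add_div, mul_add, mul_div_assoc]
          linarith
    _ = 4 * t * (∫ ω, expSum U j ω * U j ω ^ 2 ∂μ) +
          (∫ ω, expSum U j ω * (U m ω ^ e) ^ 2 ∂μ) / (2 * t) +
          (∫ ω, expSum U j ω ∂μ) * (E / (2 * t)) := by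
        rw [integral_add i12 i3, integral_add i1 i2, integral_const_mul, integral_div,
          integral_mul_const]
    _ ≤ 4 * t * (2 * v * ∫ ω, expSum U j ω ∂μ) + (2 * q * ∫ ω, expSum U j ω ∂μ) / (2 * t) +
          (∫ ω, expSum U j ω ∂μ) * (q / (2 * t)) := by
        have := (H.integral_expSum_pos j).le
        gcongr
        · exact hv j hj
        · exact hq j hj
    _ = (8 * t * v + 3 * q / (2 * t)) * ∫ ω, expSum U j ω ∂μ := by ring
    _ ≤ _ := mul_le_mul_of_nonneg_left (hA j hj) (by positivity)

/-- The normalising constants lose at most a factor two, since `exp x ≥ 1 + x` and the mean of each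
later `U l` under the density `expSum U j` is small by mixing. -/
theorem integral_expSum_le_two_mul (H : WeaklyDependent μ U G ψ τ v Γ) (hτ : 0 < τ)
    (hv : v ≤ τ ^ 2) (hsmall : 19 * τ * Γ ≤ 1) {j : ℕ}
    (hP : ∀ m, j ≤ m → ∫ ω, expSum U j ω * U m ω ^ 2 ∂μ ≤ 2 * v * ∫ ω, expSum U j ω ∂μ)
    {i : ℕ} (hji : j ≤ i) : ∫ ω, expSum U j ω ∂μ ≤ 2 * ∫ ω, expSum U i ω ∂μ := by
  have hv0 : 0 ≤ v := (integral_nonneg fun ω => sq_nonneg _).trans (H.variance_le 0)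
  have hApos := H.integral_expSum_pos j
  set A := ∫ ω, expSum U j ω ∂μ
  have hlow : ∀ l, j ≤ l → -(ψ (l - j) * (5 / 2 * τ * A)) ≤ ∫ ω, expSum U j ω * U l ω ∂μ := by
    intro l hl
    have h := H.mixing j l hl (expSum U j) (fun _ => -1) (H.measurable_expSum j)
      (fun ω => (Real.exp_pos _).le) _ (H.expSum_le j) measurable_const 1 (by simp) 1 τ hτ
    simp only [pow_one, H.centred l, sub_zero, neg_mul, one_mul, mul_neg, integral_neg, neg_sq,
      one_pow, mul_one] at h
    have i1 := (H.integrable_expSum_mul j ((H.measurable l).pow_const 2)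
      (H.abs_pow_le l 2)).div_const (2 * τ)
    have e : ∀ ω, expSum U j ω * (τ + (U l ω ^ 2 + ∫ ω, U l ω ^ 2 ∂μ) / (2 * τ)) =
        expSum U j ω * (τ + (∫ ω, U l ω ^ 2 ∂μ) / (2 * τ)) +
          expSum U j ω * U l ω ^ 2 / (2 * τ) := fun ω => by ring
    simp_rw [e] at h
    rw [integral_add ((H.integrable_expSum j).mul_const _) i1, integral_mul_const,
      integral_div] at h
    have h2 : A * (τ + (∫ ω, U l ω ^ 2 ∂μ) / (2 * τ)) +
        (∫ ω, expSum U j ω * U l ω ^ 2 ∂μ) / (2 * τ) ≤ 5 / 2 * τ * A := by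
      calc _ ≤ A * (τ + τ ^ 2 / (2 * τ)) + (2 * τ ^ 2 * A) / (2 * τ) := by
            gcongr
            · exact (H.variance_le l).trans hv
            · exact (hP l hl).trans (by gcongr)
        _ = _ := by field_simp; ring
    have := h.trans (mul_le_mul_of_nonneg_left h2 (H.coeff_nonneg (l - j)))
    linarith
  have hint : ∀ l, Integrable (fun ω => expSum U j ω * U l ω) μ := fun l =>
    H.integrable_expSum_mul j (H.measurable l) (H.bound l)
  have h1 : A + ∑ l ∈ Finset.Ico j i, ∫ ω, expSum U j ω * U l ω ∂μ ≤
      ∫ ω, expSum U i ω ∂μ := by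
    rw [← integral_finsetSum _ fun l _ => hint l, ← integral_add (H.integrable_expSum j)
      (integrable_finsetSum _ fun l _ => hint l)]
    refine integral_mono ((H.integrable_expSum j).add
      (integrable_finsetSum _ fun l _ => hint l)) (H.integrable_expSum i) fun ω => ?_
    simp only
    rw [← Finset.mul_sum]
    have : expSum U i ω = expSum U j ω * Real.exp (∑ l ∈ Finset.Ico j i, U l ω) := by
      rw [expSum, expSum, ← Real.exp_add, Finset.sum_range_add_sum_Ico _ hji]
    rw [this]
    have h3 := mul_le_mul_of_nonneg_left (Real.add_one_le_exp (∑ l ∈ Finset.Ico j i, U l ω))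
      (Real.exp_pos (∑ l ∈ Finset.range j, U l ω)).le
    simp only [expSum]
    linarith
  have h2 : -(Γ * (5 / 2 * τ * A)) ≤ ∑ l ∈ Finset.Ico j i, ∫ ω, expSum U j ω * U l ω ∂μ := by
    calc -(Γ * (5 / 2 * τ * A))
        ≤ -((∑ r ∈ Finset.range (i - j), ψ r) * (5 / 2 * τ * A)) := by
          gcongr; exact H.sum_coeff_le _
      _ = ∑ l ∈ Finset.Ico j i, -(ψ (l - j) * (5 / 2 * τ * A)) := by
          rw [Finset.sum_neg_distrib, Finset.sum_Ico_eq_sum_range, Finset.sum_mul]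
          simp
      _ ≤ _ := Finset.sum_le_sum fun l hl => hlow l (Finset.mem_Ico.1 hl).1
  nlinarith

/-- Changing the law by an exponential weight at most doubles the variance of the later
variables. -/
theorem integral_expSum_mul_sq_le (H : WeaklyDependent μ U G ψ τ v Γ) (hτ : 0 < τ)
    (hv : v ≤ τ ^ 2) (hΓ : 1 ≤ Γ) (hsmall : 19 * τ * Γ ≤ 1) (i : ℕ) :
    ∀ m, i ≤ m → ∫ ω, expSum U i ω * U m ω ^ 2 ∂μ ≤ 2 * v * ∫ ω, expSum U i ω ∂μ := by
  have hv0 : 0 ≤ v := (integral_nonneg fun ω => sq_nonneg _).trans (H.variance_le 0)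
  have hτ1 : τ ≤ 1 := by nlinarith
  induction i using Nat.strong_induction_on with
  | _ i ih =>
    intro m him
    have hpow : ∀ ω, (U m ω ^ 2) ^ 2 ≤ τ ^ 2 * U m ω ^ 2 := fun ω => by
      have := H.abs_pow_le m 2 ω
      rw [abs_of_nonneg (sq_nonneg _)] at this
      nlinarith [sq_nonneg (U m ω)]
    have hU2m := (H.measurable m).pow_const 2
    have hU4 : ∀ ω, |(U m ω ^ 2) ^ 2| ≤ (τ ^ 2) ^ 2 := fun ω => by
      rw [abs_pow]; exact pow_le_pow_left₀ (abs_nonneg _) (H.abs_pow_le m 2 ω) 2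
    have i2 : Integrable (fun ω => U m ω ^ 2) μ :=
      Integrable.of_bound hU2m.aestronglyMeasurable _ (.of_forall (H.abs_pow_le m 2))
    have i4 : Integrable (fun ω => (U m ω ^ 2) ^ 2) μ :=
      Integrable.of_bound (hU2m.pow_const 2).aestronglyMeasurable _ (.of_forall hU4)
    have h := H.integral_expSum_mul_pow_sub_le hτ1 him (e := 2) (q := τ ^ 2 * v) hτ
      (fun j hj => H.integral_expSum_le_two_mul hτ hv hsmall (ih j hj) hj.le)
      (fun j hj => ih j hj j le_rfl)
      (fun j hj => by
        calc ∫ ω, expSum U j ω * (U m ω ^ 2) ^ 2 ∂μ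
            ≤ ∫ ω, τ ^ 2 * (expSum U j ω * U m ω ^ 2) ∂μ := by
              refine integral_mono (H.integrable_expSum_mul j (hU2m.pow_const 2) hU4)
                ((H.integrable_expSum_mul j hU2m (H.abs_pow_le m 2)).const_mul _) fun ω => ?_
              have := mul_le_mul_of_nonneg_left (hpow ω)
                (Real.exp_pos (∑ l ∈ Finset.range j, U l ω)).le
              simp only [expSum]; linarith
          _ ≤ τ ^ 2 * (2 * v * ∫ ω, expSum U j ω ∂μ) := by
              rw [integral_const_mul]
              exact mul_le_mul_of_nonneg_left (ih j hj m (hj.le.trans him)) (sq_nonneg _)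
          _ = _ := by ring)
      (by
        calc ∫ ω, (U m ω ^ 2) ^ 2 ∂μ ≤ ∫ ω, τ ^ 2 * U m ω ^ 2 ∂μ :=
              integral_mono i4 (i2.const_mul _) hpow
          _ ≤ τ ^ 2 * v := by
              rw [integral_const_mul]
              exact mul_le_mul_of_nonneg_left (H.variance_le m) (sq_nonneg _))
    have hA := H.integral_expSum_pos i
    have e : ∀ ω, expSum U i ω * (U m ω ^ 2 - ∫ ω, U m ω ^ 2 ∂μ) =
        expSum U i ω * U m ω ^ 2 - expSum U i ω * ∫ ω, U m ω ^ 2 ∂μ := fun ω => by ring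
    simp_rw [e] at h
    rw [integral_sub (H.integrable_expSum_mul i hU2m (H.abs_pow_le m 2))
      ((H.integrable_expSum i).mul_const _), integral_mul_const] at h
    have e2 : 8 * τ * v + 3 * (τ ^ 2 * v) / (2 * τ) = 19 / 2 * τ * v := by field_simp; ring
    rw [e2] at h
    have h3 := mul_le_mul_of_nonneg_left (H.variance_le m) hA.le
    have h4 := mul_le_mul_of_nonneg_right hsmall (mul_nonneg hv0 hA.le)
    nlinarith

/-- A Bernstein-type bound for the Laplace transform: the variance enters linearly, multiplied by
the sum of the dependence coefficients. -/
theorem integral_exp_sum_le (H : WeaklyDependent μ U G ψ τ v Γ) (hτ : 0 < τ)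
    (hv : v ≤ τ ^ 2) (hΓ : 1 ≤ Γ) (hsmall : 19 * τ * Γ ≤ 1) (N : ℕ) :
    ∫ ω, Real.exp (∑ l ∈ Finset.range N, U l ω) ∂μ ≤ Real.exp (N * (16 * Γ * v)) := by
  have hv0 : 0 ≤ v := (integral_nonneg fun ω => sq_nonneg _).trans (H.variance_le 0)
  have hτ1 : τ ≤ 1 := by nlinarith
  have hsq := H.integral_expSum_mul_sq_le hτ hv hΓ hsmall
  change ∫ ω, expSum U N ω ∂μ ≤ _
  induction N with
  | zero => simp [expSum]
  | succ m ih =>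
    have hA := H.integral_expSum_pos m
    have h := H.integral_expSum_mul_pow_sub_le hτ1 (le_refl m) (e := 1) (q := v) (t := 1 / 2)
      (by norm_num)
      (fun j hj => H.integral_expSum_le_two_mul hτ hv hsmall (hsq j) hj.le)
      (fun j _ => hsq j j le_rfl) (fun j hj => by simpa using hsq j m hj.le)
      (by simpa using H.variance_le m)
    simp only [pow_one, H.centred m, sub_zero] at h
    have i1 := H.integrable_expSum_mul m (H.measurable m) (H.bound m)
    have i2 := H.integrable_expSum_mul m ((H.measurable m).pow_const 2) (H.abs_pow_le m 2)
    have hstep : ∫ ω, expSum U (m + 1) ω ∂μ ≤ ∫ ω, expSum U m ω ∂μ +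
        ∫ ω, expSum U m ω * U m ω ∂μ + ∫ ω, expSum U m ω * U m ω ^ 2 ∂μ := by
      have i01 : Integrable (fun ω => expSum U m ω + expSum U m ω * U m ω) μ :=
        (H.integrable_expSum m).add i1
      rw [← integral_add (H.integrable_expSum m) i1, ← integral_add i01 i2]
      refine integral_mono (H.integrable_expSum _) (i01.add i2) fun ω => ?_
      have h1 : Real.exp (U m ω) ≤ 1 + U m ω + U m ω ^ 2 := by
        have := Real.abs_exp_sub_one_sub_id_le ((H.bound m ω).trans hτ1)
        linarith [(abs_le.1 this).2]
      have h2 := mul_le_mul_of_nonneg_left h1 (Real.exp_pos (∑ l ∈ Finset.range m, U l ω)).le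
      simp only [expSum, Finset.sum_range_succ, Real.exp_add]
      linarith
    have h3 := hsq m m le_rfl
    have h4 : ∫ ω, expSum U (m + 1) ω ∂μ ≤ (∫ ω, expSum U m ω ∂μ) * (1 + 16 * Γ * v) := by
      have := mul_le_mul_of_nonneg_right hΓ (mul_nonneg hv0 hA.le)
      norm_num at h
      nlinarith
    calc _ ≤ (∫ ω, expSum U m ω ∂μ) * (1 + 16 * Γ * v) := h4
      _ ≤ Real.exp (m * (16 * Γ * v)) * Real.exp (16 * Γ * v) := by
          have := Real.add_one_le_exp (16 * Γ * v)
          gcongr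
          linarith
      _ = _ := by rw [← Real.exp_add]; push_cast; ring_nf

end WeaklyDependent

/-! ### Mixing coefficients of a stationary process -/

section Mixing

variable {Ω : Type*} [MeasurableSpace Ω] {μ : Measure Ω} {X : ℤ → Ω → ℝ} {C : ℝ}

/-- The σ-algebra `σ(X_t, t ≤ T)`. -/
abbrev pastUpTo (X : ℤ → Ω → ℝ) (T : ℤ) : MeasurableSpace Ω :=
  ⨆ t ∈ Set.Iic T, MeasurableSpace.comap (X t) inferInstance

theorem pastUpTo_le (hX : ∀ t, Measurable (X t)) (T : ℤ) : pastUpTo X T ≤ ‹MeasurableSpace Ω› :=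
  iSup₂_le fun t _ => (hX t).comap_le

theorem futureSigma_le (hX : ∀ t, Measurable (X t)) (r : ℤ) :
    futureSigma X r ≤ ‹MeasurableSpace Ω› :=
  iSup₂_le fun t _ => (hX t).comap_le

theorem cond_real_eq {A : Set Ω} (hA : MeasurableSet A) (F : Set Ω) :
    (μ[|A]).real F = (μ.real A)⁻¹ * μ.real (A ∩ F) := by
  rw [Measure.real, cond_apply hA, ENNReal.toReal_mul, ENNReal.toReal_inv]; rfl

theorem phiCoeff_nonneg (r : ℕ) : 0 ≤ phiCoeff μ X r :=
  Real.sSup_nonneg (by rintro x ⟨A, F, -, -, -, rfl⟩; exact abs_nonneg _)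

theorem one_le_of_phiMix (hmix : PhiMix μ X C) : 1 ≤ C := by
  have : 0 ≤ ∑' r : ℕ, √(phiCoeff μ X (r + 1)) := tsum_nonneg fun r => Real.sqrt_nonneg _
  linarith [hmix.2]

/-- The dependence coefficient between the past and a function of a window of `p + 1` consecutive
observations that ends `r + 1` steps later. For `r < p` the window overlaps the past. -/
noncomputable def windowCoeff (μ : Measure Ω) (X : ℤ → Ω → ℝ) (p r : ℕ) : ℝ :=
  if r < p then 1 else √(phiCoeff μ X (r - p + 1))

theorem windowCoeff_nonneg (p r : ℕ) : 0 ≤ windowCoeff μ X p r := by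
  unfold windowCoeff; split_ifs <;> positivity

theorem sum_windowCoeff_le (hmix : PhiMix μ X C) {p k : ℕ} (hp : 1 ≤ p) (hpk : p ≤ k) (n : ℕ) :
    ∑ r ∈ Finset.range n, windowCoeff μ X p r ≤ k * C := by
  have hC := one_le_of_phiMix hmix
  calc ∑ r ∈ Finset.range n, windowCoeff μ X p r
      ≤ ∑ r ∈ Finset.range (p + n), windowCoeff μ X p r :=
        Finset.sum_le_sum_of_subset_of_nonneg (Finset.range_subset_range.2 (by omega))
          fun _ _ _ => windowCoeff_nonneg _ _
    _ = ∑ r ∈ Finset.range p, 1 + ∑ r ∈ Finset.range n, √(phiCoeff μ X (r + 1)) := by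
        rw [Finset.sum_range_add]
        congr 1
        · exact Finset.sum_congr rfl fun r hr => if_pos (Finset.mem_range.1 hr)
        · refine Finset.sum_congr rfl fun r _ => ?_
          rw [windowCoeff, if_neg (by omega)]; simp
    _ ≤ p + (C - 1) := by
        have h1 := hmix.1.sum_le_tsum (Finset.range n) fun r _ => Real.sqrt_nonneg _
        have h2 := hmix.2
        simp only [Finset.sum_const, Finset.card_range, nsmul_eq_mul, mul_one]
        linarith
    _ ≤ k * C := by
        have h1 : (1 : ℝ) ≤ p := by exact_mod_cast hp
        have h2 : (p : ℝ) ≤ k := by exact_mod_cast hpk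
        nlinarith

variable [IsProbabilityMeasure μ]

theorem bddAbove_phiCoeff_set (r : ℕ) : BddAbove {x : ℝ | ∃ A F : Set Ω,
    MeasurableSet[pastSigma X] A ∧ MeasurableSet[futureSigma X r] F ∧ μ A ≠ 0 ∧
      x = |(μ[|A]).real F - μ.real F|} := by
  refine ⟨1, ?_⟩
  rintro x ⟨A, F, -, -, hA, rfl⟩
  have : IsProbabilityMeasure (μ[|A]) := cond_isProbabilityMeasure hA
  have h1 : (μ[|A]).real F ≤ 1 := measureReal_le_one
  have h2 : μ.real F ≤ 1 := measureReal_le_one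
  have h3 : 0 ≤ (μ[|A]).real F := measureReal_nonneg
  have h4 : 0 ≤ μ.real F := measureReal_nonneg
  rw [abs_le]; constructor <;> linarith

theorem abs_real_inter_sub_le_phiCoeff (hX : ∀ t, Measurable (X t)) {r : ℕ} {A F : Set Ω}
    (hA : MeasurableSet[pastSigma X] A) (hF : MeasurableSet[futureSigma X r] F) :
    |μ.real (A ∩ F) - μ.real A * μ.real F| ≤ phiCoeff μ X r * μ.real A := by
  have hA' : MeasurableSet A := pastUpTo_le hX 0 A hA
  rcases eq_or_ne (μ A) 0 with h0 | h0
  · have h1 : μ (A ∩ F) = 0 := measure_mono_null Set.inter_subset_left h0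
    simp [Measure.real, h0, h1]
  have hpos : 0 < μ.real A := ENNReal.toReal_pos h0 (measure_ne_top _ _)
  have h := le_csSup (bddAbove_phiCoeff_set (μ := μ) (X := X) r) ⟨A, F, hA, hF, h0, rfl⟩
  rw [cond_real_eq hA'] at h
  have e : μ.real (A ∩ F) - μ.real A * μ.real F =
      μ.real A * ((μ.real A)⁻¹ * μ.real (A ∩ F) - μ.real F) := by field_simp
  rw [e, abs_mul, abs_of_pos hpos, mul_comm]
  exact mul_le_mul_of_nonneg_right h hpos.le

/-- The mixing coefficients depend on the law of the process only: they are those of the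
coordinate process on the path space. -/
theorem phiCoeff_eq_map (hX : ∀ t, Measurable (X t)) (r : ℕ) :
    phiCoeff μ X r =
      phiCoeff (μ.map fun ω t => X t ω) (fun (t : ℤ) (x : ℤ → ℝ) => x t) r := by
  have hpath : Measurable fun ω t => X t ω := measurable_pi_lambda _ hX
  have := Measure.isProbabilityMeasure_map (μ := μ) hpath.aemeasurable
  have hcoord : ∀ t : ℤ, Measurable fun x : ℤ → ℝ => x t := measurable_pi_apply
  have hcomap : ∀ S : Set ℤ, (⨆ t ∈ S, MeasurableSpace.comap (X t) inferInstance) =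
      (⨆ t ∈ S, MeasurableSpace.comap (fun x : ℤ → ℝ => x t) inferInstance).comap
        fun ω t => X t ω := fun S => by
    simp only [MeasurableSpace.comap_iSup, MeasurableSpace.comap_comp]; rfl
  have hval : ∀ A F : Set (ℤ → ℝ), MeasurableSet A → MeasurableSet F →
      |((μ.map fun ω t => X t ω)[|A]).real F - (μ.map fun ω t => X t ω).real F| =
        |(μ[|(fun ω t => X t ω) ⁻¹' A]).real ((fun ω t => X t ω) ⁻¹' F) -
          μ.real ((fun ω t => X t ω) ⁻¹' F)| := fun A F hA hF => by
    rw [cond_real_eq hA, cond_real_eq (hpath hA), map_measureReal_apply hpath hA,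
      map_measureReal_apply hpath hF, map_measureReal_apply hpath (hA.inter hF), Set.preimage_inter]
  unfold phiCoeff
  congr 1
  ext x
  constructor
  · rintro ⟨A, F, hA, hF, h0, rfl⟩
    rw [pastSigma, hcomap] at hA
    rw [futureSigma, hcomap] at hF
    obtain ⟨A', hA', rfl⟩ := hA
    obtain ⟨F', hF', rfl⟩ := hF
    have mA := pastUpTo_le hcoord 0 A' hA'
    have mF := futureSigma_le hcoord r F' hF'
    exact ⟨A', F', hA', hF', by rwa [Measure.map_apply hpath mA], (hval A' F' mA mF).symm⟩
  · rintro ⟨A', F', hA', hF', h0, rfl⟩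
    have mA := pastUpTo_le hcoord 0 A' hA'
    have mF := futureSigma_le hcoord r F' hF'
    refine ⟨_, _, ?_, ?_, by rwa [Measure.map_apply hpath mA] at h0, hval A' F' mA mF⟩
    · rw [pastSigma, hcomap]; exact ⟨A', hA', rfl⟩
    · rw [futureSigma, hcomap]; exact ⟨F', hF', rfl⟩

/-- By stationarity, the mixing coefficients compare the past and the future of any time `T`. -/
theorem abs_real_inter_sub_le_of_isStationary (hX : ∀ t, Measurable (X t))
    (hst : IsStationary μ X) (T : ℤ) {r : ℕ} {A F : Set Ω}
    (hA : MeasurableSet[pastUpTo X T] A) (hF : MeasurableSet[futureSigma X (T + r)] F) :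
    |μ.real (A ∩ F) - μ.real A * μ.real F| ≤ phiCoeff μ X r * μ.real A := by
  have hY : ∀ t, Measurable (fun ω => X (t + T) ω) := fun t => hX (t + T)
  rw [phiCoeff_eq_map hX, ← (hst T).map_eq, ← phiCoeff_eq_map hY]
  refine abs_real_inter_sub_le_phiCoeff hY ?_ ?_
  · refine (?_ : pastUpTo X T ≤ pastSigma fun t => X (t + T)) A hA
    refine iSup₂_le fun t ht => ?_
    have := le_iSup₂ (f := fun (s : ℤ) (_ : s ∈ Set.Iic (0 : ℤ)) =>
      MeasurableSpace.comap (X (s + T)) inferInstance) (t - T) (by simpa using ht)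
    rw [sub_add_cancel] at this
    exact this
  · refine (?_ : futureSigma X (T + r) ≤ futureSigma (fun t => X (t + T)) r) F hF
    refine iSup₂_le fun t ht => ?_
    have := le_iSup₂ (f := fun (s : ℤ) (_ : s ∈ Set.Ici (r : ℤ)) =>
      MeasurableSpace.comap (X (s + T)) inferInstance) (t - T)
      (by simp only [Set.mem_Ici] at ht ⊢; linarith)
    rw [sub_add_cancel] at this
    exact this

end Mixing

/-! ### Prediction losses -/

section Loss

variable {Ω : Type*} {X : ℤ → Ω → ℝ} {B C L : ℝ} {p : ℕ}

theorem measurable_predictor {m : MeasurableSpace Ω} {t : ℤ}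
    (h : ∀ s, t - p ≤ s → s ≤ t → Measurable[m] (X s)) (θ : Fin p → ℝ) :
    Measurable[m] (predictor X θ t) := by
  unfold predictor
  refine Finset.measurable_sum _ fun j _ => (h _ ?_ ?_).const_mul _ <;> omega

theorem abs_predictor_le (hb : ∀ t ω, |X t ω| ≤ B) {θ : Fin p → ℝ} (hθ : θ ∈ Theta p L)
    (hB : 0 ≤ B) (t : ℤ) (ω : Ω) : |predictor X θ t ω| ≤ L * B := by
  calc |predictor X θ t ω| ≤ ∑ j : Fin p, |θ j * X (t - ((j : ℤ) + 1)) ω| :=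
        Finset.abs_sum_le_sum_abs _ _
    _ ≤ ∑ j : Fin p, |θ j| * B := by
        refine Finset.sum_le_sum fun j _ => ?_
        rw [abs_mul]; exact mul_le_mul_of_nonneg_left (hb _ _) (abs_nonneg _)
    _ = (∑ j, |θ j|) * B := by rw [Finset.sum_mul]
    _ ≤ L * B := mul_le_mul_of_nonneg_right hθ hB

theorem abs_predictor_sub_le (hb : ∀ t ω, |X t ω| ≤ B) {θ : Fin p → ℝ} (hθ : θ ∈ Theta p L)
    (hB : 0 ≤ B) (t : ℤ) (ω : Ω) : |predictor X θ t ω - X t ω| ≤ (1 + L) * B := by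
  have h1 := abs_predictor_le hb hθ hB t ω
  have h2 := hb t ω
  have := abs_sub (predictor X θ t ω) (X t ω)
  linarith

theorem sq_predictor_sub_le (hb : ∀ t ω, |X t ω| ≤ B) {θ : Fin p → ℝ} (hθ : θ ∈ Theta p L)
    (hB : 0 ≤ B) (t : ℤ) (ω : Ω) :
    (predictor X θ t ω - X t ω) ^ 2 ≤ ((1 + L) * B) ^ 2 := by
  rw [← sq_abs]; exact pow_le_pow_left₀ (abs_nonneg _) (abs_predictor_sub_le hb hθ hB t ω) 2

theorem predictor_add_smul (θ θ' : Fin p → ℝ) (c c' : ℝ) (t : ℤ) (ω : Ω) :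
    predictor X (c • θ + c' • θ') t ω = c * predictor X θ t ω + c' * predictor X θ' t ω := by
  simp only [predictor, Pi.add_apply, Pi.smul_apply, smul_eq_mul, Finset.mul_sum]
  rw [← Finset.sum_add_distrib]
  exact Finset.sum_congr rfl fun j _ => by ring

/-- The predictor of a bounded process is bounded by a multiple of the `ℓ¹` norm. -/
theorem abs_predictor_le_sum (hb : ∀ t ω, |X t ω| ≤ B) (hB : 0 ≤ B) (θ : Fin p → ℝ) (t : ℤ)
    (ω : Ω) : |predictor X θ t ω| ≤ (∑ j, |θ j|) * B :=
  abs_predictor_le (L := ∑ j, |θ j|) hb (le_refl (∑ j, |θ j|)) hB t ω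

theorem abs_residual_le (hb : ∀ t ω, |X t ω| ≤ B) (hB : 0 ≤ B) (θ : Fin p → ℝ) (t : ℤ) (ω : Ω) :
    |predictor X θ t ω - X t ω| ≤ (∑ j, |θ j|) * B + B :=
  (abs_sub _ _).trans (add_le_add (abs_predictor_le_sum hb hB θ t ω) (hb t ω))

/-- The excess of the loss of `θ` over that of `θ'` at time `t`. -/
noncomputable def lossDiff (X : ℤ → Ω → ℝ) (θ θ' : Fin p → ℝ) (t : ℤ) (ω : Ω) : ℝ :=
  (predictor X θ t ω - X t ω) ^ 2 - (predictor X θ' t ω - X t ω) ^ 2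

theorem measurable_lossDiff {m : MeasurableSpace Ω} {t : ℤ}
    (h : ∀ s, t - p ≤ s → s ≤ t → Measurable[m] (X s)) (θ θ' : Fin p → ℝ) :
    Measurable[m] (lossDiff X θ θ' t) :=
  (((measurable_predictor h θ).sub (h t (by omega) le_rfl)).pow_const 2).sub
    (((measurable_predictor h θ').sub (h t (by omega) le_rfl)).pow_const 2)

theorem abs_lossDiff_le (hb : ∀ t ω, |X t ω| ≤ B) (hB : 0 ≤ B) {θ θ' : Fin p → ℝ}
    (hθ : θ ∈ Theta p L) (hθ' : θ' ∈ Theta p L) (t : ℤ) (ω : Ω) :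
    |lossDiff X θ θ' t ω| ≤ ((1 + L) * B) ^ 2 := by
  have h1 := sq_predictor_sub_le hb hθ hB t ω
  have h2 := sq_predictor_sub_le hb hθ' hB t ω
  rw [lossDiff, abs_le]
  constructor <;> nlinarith [sq_nonneg (predictor X θ t ω - X t ω),
    sq_nonneg (predictor X θ' t ω - X t ω)]

theorem measurable_coord_lossDiff (θ θ' : Fin p → ℝ) :
    Measurable (lossDiff (fun (s : ℤ) (x : ℤ → ℝ) => x s) θ θ' 0) :=
  measurable_lossDiff (fun s _ _ => measurable_pi_apply s) θ θ'

theorem lossDiff_eq_shift (θ θ' : Fin p → ℝ) (t : ℤ) (ω : Ω) :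
    lossDiff X θ θ' t ω =
      lossDiff (fun (s : ℤ) (x : ℤ → ℝ) => x s) θ θ' 0 (fun s => X (s + t) ω) := by
  simp only [lossDiff, predictor, zero_add, zero_sub]
  have : ∀ j : Fin p, t - ((j : ℤ) + 1) = -((j : ℤ) + 1) + t := fun j => by ring
  simp_rw [this]

theorem empRisk_sub_empRisk {n k : ℕ} (hkn : k < n) (θ θ' : Fin p → ℝ) (ω : Ω) :
    empRisk X n k θ ω - empRisk X n k θ' ω =
      ((n : ℝ) - k)⁻¹ * ∑ l ∈ Finset.range (n - k), lossDiff X θ θ' (k + 1 + l : ℤ) ω := by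
  rw [empRisk, empRisk, ← mul_sub, ← Finset.sum_sub_distrib]
  congr 1
  rw [← Finset.Ico_add_one_right_eq_Icc, Finset.sum_Ico_eq_sum_range,
    show n + 1 - (k + 1) = n - k by omega]
  refine Finset.sum_congr rfl fun l _ => ?_
  simp only [lossDiff]; push_cast; rfl

variable [MeasurableSpace Ω] {μ : Measure Ω}

theorem risk_nonneg (θ : Fin p → ℝ) : 0 ≤ risk μ X θ := integral_nonneg fun _ => sq_nonneg _

theorem integral_comp_shift (hst : IsStationary μ X) (t : ℤ) {f : (ℤ → ℝ) → ℝ} (hf : Measurable f) :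
    ∫ ω, f (fun s => X (s + t) ω) ∂μ = ∫ ω, f (fun s => X s ω) ∂μ :=
  ((hst t).comp hf).integral_eq

variable [IsProbabilityMeasure μ]

theorem integrable_mul_of_bounded {f g : Ω → ℝ} (hf : Measurable f) (hg : Measurable g) {K K' : ℝ}
    (hK : ∀ ω, |f ω| ≤ K) (hK' : ∀ ω, |g ω| ≤ K') : Integrable (fun ω => f ω * g ω) μ :=
  (Integrable.of_bound hg.aestronglyMeasurable K' (.of_forall hK')).bdd_mul
    hf.aestronglyMeasurable (.of_forall hK)

theorem integrable_sq_residual (hX : ∀ t, Measurable (X t)) (hb : ∀ t ω, |X t ω| ≤ B)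
    (hB : 0 ≤ B) (θ : Fin p → ℝ) (t : ℤ) :
    Integrable (fun ω => (predictor X θ t ω - X t ω) ^ 2) μ := by
  have hm := (measurable_predictor (t := t) (fun s _ _ => hX s) θ).sub (hX t)
  simp_rw [pow_two]
  exact integrable_mul_of_bounded hm hm (abs_residual_le hb hB θ t) (abs_residual_le hb hB θ t)

theorem risk_le (hX : ∀ t, Measurable (X t)) (hb : ∀ t ω, |X t ω| ≤ B) (hB : 0 ≤ B)
    {θ : Fin p → ℝ} (hθ : θ ∈ Theta p L) : risk μ X θ ≤ ((1 + L) * B) ^ 2 := by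
  have := integral_mono (integrable_sq_residual (μ := μ) hX hb hB θ 0) (integrable_const _)
    (fun ω => sq_predictor_sub_le hb hθ hB 0 ω)
  simpa [risk] using this

theorem integral_lossDiff (hX : ∀ t, Measurable (X t)) (hst : IsStationary μ X)
    (hb : ∀ t ω, |X t ω| ≤ B) (hB : 0 ≤ B) (θ θ' : Fin p → ℝ) (t : ℤ) :
    ∫ ω, lossDiff X θ θ' t ω ∂μ = risk μ X θ - risk μ X θ' := by
  simp_rw [lossDiff_eq_shift θ θ' t]
  rw [integral_comp_shift hst t (measurable_coord_lossDiff θ θ')]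
  exact integral_sub (integrable_sq_residual hX hb hB θ 0) (integrable_sq_residual hX hb hB θ' 0)

/-- At a global minimiser of the risk, the excess risk is the squared `L²` distance of the
predictors: the residual of the best predictor is orthogonal to all predictors. -/
theorem integral_sq_predictor_sub_eq (hX : ∀ t, Measurable (X t)) (hb : ∀ t ω, |X t ω| ≤ B)
    (hB : 0 ≤ B) {θbar : Fin p → ℝ} (hmin : ∀ θ : Fin p → ℝ, risk μ X θbar ≤ risk μ X θ)
    (θ : Fin p → ℝ) :
    ∫ ω, (predictor X θ 0 ω - predictor X θbar 0 ω) ^ 2 ∂μ = risk μ X θ - risk μ X θbar := by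
  have mp : ∀ θ : Fin p → ℝ, Measurable (predictor X θ 0) := fun θ =>
    measurable_predictor (t := 0) (fun s _ _ => hX s) θ
  set w : Ω → ℝ := fun ω => predictor X θbar 0 ω - X 0 ω
  set d : Ω → ℝ := fun ω => predictor X θ 0 ω - predictor X θbar 0 ω
  have mw : Measurable w := (mp θbar).sub (hX 0)
  have md : Measurable d := (mp θ).sub (mp θbar)
  have bw := abs_residual_le hb hB θbar 0
  have bd : ∀ ω, |d ω| ≤ (∑ j, |θ j|) * B + (∑ j, |θbar j|) * B := fun ω =>
    (abs_sub _ _).trans (add_le_add (abs_predictor_le_sum hb hB θ 0 ω)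
      (abs_predictor_le_sum hb hB θbar 0 ω))
  have iww : Integrable (fun ω => w ω * w ω) μ := integrable_mul_of_bounded mw mw bw bw
  have iwd : Integrable (fun ω => w ω * d ω) μ := integrable_mul_of_bounded mw md bw bd
  have idd : Integrable (fun ω => d ω * d ω) μ := integrable_mul_of_bounded md md bd bd
  have expand : ∀ s : ℝ, risk μ X ((1 - s) • θbar + s • θ) =
      ∫ ω, w ω * w ω ∂μ + 2 * s * ∫ ω, w ω * d ω ∂μ + s ^ 2 * ∫ ω, d ω * d ω ∂μ := by
    intro s
    have i1 : Integrable (fun ω => w ω * w ω + 2 * s * (w ω * d ω)) μ := iww.add (iwd.const_mul _)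
    rw [← integral_const_mul, ← integral_const_mul, ← integral_add iww (iwd.const_mul _),
      ← integral_add i1 (idd.const_mul _), risk]
    refine integral_congr_ae (.of_forall fun ω => ?_)
    simp only [predictor_add_smul, w, d]
    ring
  have h0 := expand 0
  have h1 := expand 1
  simp only [sub_zero, one_smul, zero_smul, add_zero, sub_self, zero_add, mul_zero, zero_mul,
    ne_eq, OfNat.ofNat_ne_zero, not_false_eq_true, zero_pow, one_pow, mul_one, one_mul] at h0 h1
  have hwd : ∫ ω, w ω * d ω ∂μ = 0 := by
    have hquad : ∀ s : ℝ, 0 ≤ (∫ ω, d ω * d ω ∂μ) * (s * s) + (2 * ∫ ω, w ω * d ω ∂μ) * s + 0 := by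
      intro s
      have := hmin ((1 - s) • θbar + s • θ)
      rw [expand s, h0] at this
      linarith
    have := discrim_le_zero hquad
    rw [discrim] at this
    nlinarith [sq_nonneg (∫ ω, w ω * d ω ∂μ)]
  rw [h1, h0, hwd]
  simp only [pow_two]
  ring

/-- The second moment of the excess loss is controlled by the excess risk: the excess loss is
`predictor θ - predictor θbar` times a bounded factor, and the square of the difference integrates
to the excess risk. -/
theorem integral_lossDiff_sq_le (hX : ∀ t, Measurable (X t)) (hst : IsStationary μ X)
    (hb : ∀ t ω, |X t ω| ≤ B) (hB : 0 ≤ B) {θ θbar : Fin p → ℝ}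
    (hθ : θ ∈ Theta p L) (hθbar : θbar ∈ Theta p L)
    (hmin : ∀ θ : Fin p → ℝ, risk μ X θbar ≤ risk μ X θ) (t : ℤ) :
    ∫ ω, lossDiff X θ θbar t ω ^ 2 ∂μ ≤
      4 * ((1 + L) * B) ^ 2 * (risk μ X θ - risk μ X θbar) := by
  have hsh : ∫ ω, lossDiff X θ θbar t ω ^ 2 ∂μ = ∫ ω, lossDiff X θ θbar 0 ω ^ 2 ∂μ := by
    have := integral_comp_shift hst t ((measurable_coord_lossDiff θ θbar).pow_const 2)
    simp_rw [lossDiff_eq_shift θ θbar t, this]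
    rfl
  rw [hsh, ← integral_sq_predictor_sub_eq hX hb hB hmin θ, ← integral_const_mul]
  have mp : ∀ θ : Fin p → ℝ, Measurable (predictor X θ 0) := fun θ =>
    measurable_predictor (t := 0) (fun s _ _ => hX s) θ
  have bd : ∀ ω, |predictor X θ 0 ω - predictor X θbar 0 ω| ≤ L * B + L * B := fun ω =>
    (abs_sub _ _).trans (add_le_add (abs_predictor_le hb hθ hB 0 ω)
      (abs_predictor_le hb hθbar hB 0 ω))
  have id2 : Integrable (fun ω => (predictor X θ 0 ω - predictor X θbar 0 ω) ^ 2) μ := by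
    simp_rw [pow_two]
    exact integrable_mul_of_bounded ((mp θ).sub (mp θbar)) ((mp θ).sub (mp θbar)) bd bd
  refine integral_mono_of_nonneg (.of_forall fun ω => sq_nonneg _) (id2.const_mul _)
    (.of_forall fun ω => ?_)
  have h1 := abs_le.1 (abs_predictor_sub_le hb hθ hB 0 ω)
  have h2 := abs_le.1 (abs_predictor_sub_le hb hθbar hB 0 ω)
  have h3 : (predictor X θ 0 ω + predictor X θbar 0 ω - 2 * X 0 ω) ^ 2 ≤
      4 * ((1 + L) * B) ^ 2 := by nlinarith
  have e : lossDiff X θ θbar 0 ω ^ 2 = (predictor X θ 0 ω + predictor X θbar 0 ω - 2 * X 0 ω) ^ 2 *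
      (predictor X θ 0 ω - predictor X θbar 0 ω) ^ 2 := by simp only [lossDiff]; ring
  simp only [e]
  exact mul_le_mul_of_nonneg_right h3 (sq_nonneg _)

/-- The scaled centred excess losses form a weakly dependent sequence. -/
theorem weaklyDependent_lossDiff (hX : ∀ t, Measurable (X t)) (hst : IsStationary μ X)
    (hb : ∀ t ω, |X t ω| ≤ B) (hB : 0 ≤ B) (hmix : PhiMix μ X C) {θ θbar : Fin p → ℝ}
    (hθ : θ ∈ Theta p L) (hθbar : θbar ∈ Theta p L)
    (hmin : ∀ θ : Fin p → ℝ, risk μ X θbar ≤ risk μ X θ) {k : ℕ} (hp : 1 ≤ p) (hpk : p ≤ k)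
    (s : ℝ) :
    WeaklyDependent μ
      (fun l ω => s * (lossDiff X θ θbar (k + 1 + l : ℤ) ω - (risk μ X θ - risk μ X θbar)))
      (fun i => pastUpTo X (k + i)) (windowCoeff μ X p)
      (|s| * (2 * ((1 + L) * B) ^ 2))
      (s ^ 2 * (4 * ((1 + L) * B) ^ 2 * (risk μ X θ - risk μ X θbar))) (k * C) := by
  have hXm : ∀ (T t : ℤ), t ≤ T → Measurable[pastUpTo X T] (X t) := fun T t ht =>
    (comap_measurable (X t)).mono (le_iSup₂ (f := fun (s : ℤ) (_ : s ∈ Set.Iic T) =>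
      MeasurableSpace.comap (X s) inferInstance) t ht) le_rfl
  have hXf : ∀ (T t : ℤ), T ≤ t → Measurable[futureSigma X T] (X t) := fun T t ht =>
    (comap_measurable (X t)).mono (le_iSup₂ (f := fun (s : ℤ) (_ : s ∈ Set.Ici T) =>
      MeasurableSpace.comap (X s) inferInstance) t ht) le_rfl
  set D := risk μ X θ - risk μ X θbar with hD
  have hD0 : 0 ≤ D := sub_nonneg.2 (hmin θ)
  have hDb : D ≤ ((1 + L) * B) ^ 2 := by
    have h1 := risk_le (μ := μ) hX hb hB hθ
    have h2 := risk_nonneg (μ := μ) (X := X) θbar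
    linarith
  have hbound : ∀ (l : ℕ) ω, |s * (lossDiff X θ θbar (k + 1 + l : ℤ) ω - D)| ≤
      |s| * (2 * ((1 + L) * B) ^ 2) := fun l ω => by
    rw [abs_mul]
    refine mul_le_mul_of_nonneg_left ?_ (abs_nonneg s)
    have := abs_lossDiff_le hb hB hθ hθbar (k + 1 + l : ℤ) ω
    have h2 := abs_sub (lossDiff X θ θbar (k + 1 + l : ℤ) ω) D
    rw [abs_of_nonneg hD0] at h2
    linarith
  have hmeas : ∀ t, Measurable (lossDiff X θ θbar t) := fun t =>
    measurable_lossDiff (fun s _ _ => hX s) θ θbar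
  have hint : ∀ t, Integrable (lossDiff X θ θbar t) μ := fun t =>
    Integrable.of_bound (hmeas t).aestronglyMeasurable _
      (.of_forall (abs_lossDiff_le hb hB hθ hθbar t))
  have hint2 : ∀ t, Integrable (fun ω => lossDiff X θ θbar t ω ^ 2) μ := fun t => by
    simp_rw [pow_two]
    exact integrable_mul_of_bounded (hmeas t) (hmeas t) (abs_lossDiff_le hb hB hθ hθbar t)
      (abs_lossDiff_le hb hB hθ hθbar t)
  refine ⟨?_, fun i => pastUpTo_le hX _, ?_, hbound, ?_, ?_, windowCoeff_nonneg p,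
    sum_windowCoeff_le hmix hp hpk, ?_⟩
  · intro i j hij
    refine iSup₂_le fun t ht => le_iSup₂ (f := fun (s : ℤ) (_ : s ∈ Set.Iic ((k : ℤ) + j)) =>
      MeasurableSpace.comap (X s) inferInstance) t ?_
    simp only [Set.mem_Iic] at ht ⊢; omega
  · intro l
    refine ((measurable_lossDiff (fun u _ hu => hXm _ u ?_) θ θbar).sub_const _).const_mul _
    push_cast; omega
  · intro l
    rw [integral_const_mul, integral_sub (hint _) (integrable_const _),
      integral_lossDiff hX hst hb hB]
    simp [D]
  · intro l
    have e : ∀ ω, (s * (lossDiff X θ θbar (k + 1 + l : ℤ) ω - D)) ^ 2 =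
        s ^ 2 * (lossDiff X θ θbar (k + 1 + l : ℤ) ω ^ 2 -
          (2 * D * lossDiff X θ θbar (k + 1 + l : ℤ) ω - D ^ 2)) := fun ω => by ring
    have i3 : Integrable (fun ω => 2 * D * lossDiff X θ θbar (k + 1 + l : ℤ) ω - D ^ 2) μ :=
      ((hint _).const_mul _).sub (integrable_const _)
    simp_rw [e]
    rw [integral_const_mul, integral_sub (hint2 _) i3,
      integral_sub ((hint _).const_mul _) (integrable_const _), integral_const_mul,
      integral_lossDiff hX hst hb hB]
    refine mul_le_mul_of_nonneg_left ?_ (sq_nonneg s)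
    have := integral_lossDiff_sq_le hX hst hb hB hθ hθbar hmin (k + 1 + l : ℤ)
    simp only [integral_const, probReal_univ, one_smul]
    nlinarith [sq_nonneg D]
  · intro i m him W h hW hW0 KW hKW hh Kh hKh e t ht
    have hUb : ∀ ω, |(s * (lossDiff X θ θbar (k + 1 + m : ℤ) ω - D)) ^ e| ≤
        (|s| * (2 * ((1 + L) * B) ^ 2)) ^ e := fun ω => by
      rw [abs_pow]; exact pow_le_pow_left₀ (abs_nonneg _) (hbound m ω) e
    rcases lt_or_ge (m - i) p with hlt | hge
    · rw [windowCoeff, if_pos hlt]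
      exact integral_weight_mul_sub_le (hW.mono (pastUpTo_le hX _) le_rfl) hW0 hKW
        (hh.mono (pastUpTo_le hX _) le_rfl) hKh
        ((((hmeas _).sub_const _).const_mul _).pow_const e) hUb ht
    · rw [windowCoeff, if_neg (not_lt.2 hge)]
      refine integral_weight_mul_sub_le_of_mixing (pastUpTo_le hX _)
        (futureSigma_le hX ((k + i : ℤ) + ((m - i - p + 1 : ℕ) : ℤ))) (Real.sqrt_nonneg _)
        (fun A F hA hF => ?_) hW hW0 hKW hh hKh ?_ hUb ht
      · rw [Real.sq_sqrt (phiCoeff_nonneg _)]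
        exact abs_real_inter_sub_le_of_isStationary hX hst (k + i : ℤ) hA hF
      · refine (((measurable_lossDiff (fun u hu _ => hXf _ u ?_) θ θbar).sub_const _).const_mul
          _).pow_const e
        omega

/-- The exponential inequality for the excess empirical risk, for deviations in either direction
(`σ = ±1`). The variance of the excess loss is at most a multiple of the excess risk, which turns
the Bernstein-type bound into one by a fraction of the excess risk. -/
theorem integral_exp_empRisk_le (hX : ∀ t, Measurable (X t)) (hst : IsStationary μ X)
    (hb : ∀ t ω, |X t ω| ≤ B) (hB : 0 < B) (hL : 0 < L) (hmix : PhiMix μ X C)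
    {θ θbar : Fin p → ℝ} (hθ : θ ∈ Theta p L) (hθbar : θbar ∈ Theta p L)
    (hmin : ∀ θ : Fin p → ℝ, risk μ X θbar ≤ risk μ X θ) {n k : ℕ} (hp : 1 ≤ p) (hpk : p ≤ k)
    (hkn : k < n) {c₀ : ℝ} (hc : 128 * C * ((1 + L) * B) ^ 2 ≤ c₀) {σ : ℝ} (hσ : |σ| = 1) :
    ∫ ω, Real.exp (σ * (((n : ℝ) - k) / (c₀ * k)) * (empRisk X n k θ ω - empRisk X n k θbar ω -
      (risk μ X θ - risk μ X θbar))) ∂μ ≤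
      Real.exp (((n : ℝ) - k) / (c₀ * k) * (risk μ X θ - risk μ X θbar) / 2) := by
  have hC := one_le_of_phiMix hmix
  set b := ((1 + L) * B) ^ 2
  have hb0 : 0 < b := by positivity
  have hk1 : (1 : ℝ) ≤ k := by exact_mod_cast hp.trans hpk
  have hN : (0 : ℝ) < (n : ℝ) - k := sub_pos.2 (by exact_mod_cast hkn)
  have hNc : ((n - k : ℕ) : ℝ) = (n : ℝ) - k := Nat.cast_sub hkn.le
  have hc0 : 0 < c₀ := lt_of_lt_of_le (by positivity) hc
  set D := risk μ X θ - risk μ X θbar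
  have hD0 : 0 ≤ D := sub_nonneg.2 (hmin θ)
  have hDb : D ≤ b := by
    have h1 := risk_le (μ := μ) hX hb hB.le hθ
    have h2 := risk_nonneg (μ := μ) (X := X) θbar
    linarith
  set s := 1 / (c₀ * k) with hs
  have hs0 : 0 < s := by positivity
  have hσs : |σ * s| = s := by rw [abs_mul, hσ, one_mul, abs_of_pos hs0]
  have hσ2 : σ ^ 2 = 1 := by rw [← sq_abs, hσ, one_pow]
  have hbs : C * b * (s * k) ≤ 1 / 128 := by
    have : s * k = 1 / c₀ := by rw [hs]; field_simp
    rw [this, mul_one_div, div_le_div_iff₀ hc0 (by norm_num)]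
    linarith
  have H := weaklyDependent_lossDiff hX hst hb hB.le hmix hθ hθbar hmin hp hpk (σ * s)
  rw [hσs] at H
  have key := H.integral_exp_sum_le (by positivity) (by
      rw [mul_pow, hσ2]
      have : s ^ 2 * (4 * b * D) ≤ s ^ 2 * (4 * b * b) := by gcongr
      nlinarith) (by nlinarith)
    (by nlinarith) (n - k)
  refine le_trans (le_of_eq ?_) (key.trans (Real.exp_le_exp.2 ?_))
  · refine integral_congr_ae (.of_forall fun ω => ?_)
    simp only
    congr 1
    rw [empRisk_sub_empRisk hkn, ← Finset.mul_sum, Finset.sum_sub_distrib, Finset.sum_const,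
      Finset.card_range, nsmul_eq_mul, hNc, hs]
    change _ = σ * (1 / (c₀ * k)) * (_ - ((n : ℝ) - k) * D)
    field_simp
  · rw [hNc, mul_pow, hσ2]
    have e : ((n : ℝ) - k) / (c₀ * k) = ((n : ℝ) - k) * s := by rw [hs]; ring
    rw [e]
    have h1 := mul_le_mul_of_nonneg_left hbs (by positivity : 0 ≤ 64 * (((n : ℝ) - k) * s * D))
    linarith

end Loss

/-! ### The prior -/

section Prior

variable {p : ℕ} {L : ℝ} {J : Finset (Fin p)}

theorem sum_extendZero (f : Fin p → ℝ → ℝ) (hf : ∀ j, f j 0 = 0) (v : J → ℝ) :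
    ∑ j, f j (extendZero J v j) = ∑ j : J, f j (v j) := by
  rw [← Finset.sum_subset (Finset.subset_univ J) (fun j _ hj => by simp [extendZero, hj, hf]),
    ← Finset.sum_coe_sort J]
  exact Finset.sum_congr rfl fun j _ => by simp [extendZero]

theorem measurable_extendZero : Measurable (extendZero J) := by
  refine measurable_pi_lambda _ fun j => ?_
  by_cases h : j ∈ J
  · simpa [extendZero, h] using measurable_pi_apply _
  · simp [extendZero, h]

theorem extendZero_restrict {θ : Fin p → ℝ} (hθ : θ ∈ ThetaJ p L J) :
    extendZero J (fun j => θ j) = θ := by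
  funext j
  by_cases h : j ∈ J
  · simp [extendZero, h]
  · have := (hθ.2 j).not.2 h
    simp only [extendZero, h, dite_false]
    exact (not_not.1 this).symm

/-- The closed `ℓ¹` ball of radius `L` in `ℝ^J`. -/
def ballL1 (J : Finset (Fin p)) (L : ℝ) : Set (J → ℝ) := {v | ∑ j, |v j| ≤ L}

theorem preimage_extendZero_thetaJ :
    extendZero J ⁻¹' ThetaJ p L J = ballL1 J L ∩ {v | ∀ j, v j ≠ 0} := by
  ext v
  simp only [Set.mem_preimage, ThetaJ, ballL1, Set.mem_ofPred_eq, Set.mem_inter_iff]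
  rw [sum_extendZero (fun _ x => |x|) (by simp)]
  refine and_congr_right fun _ => ⟨fun h j => ?_, fun h j => ?_⟩
  · have := (h j).2 j.2
    simpa [extendZero] using this
  · by_cases hj : j ∈ J
    · simpa [extendZero, hj] using h ⟨j, hj⟩
    · simp [extendZero, hj]

theorem continuous_sum_abs {ι : Type*} [Fintype ι] : Continuous fun v : ι → ℝ => ∑ j, |v j| :=
  continuous_finsetSum _ fun j _ => (continuous_apply j).abs

theorem measurableSet_ballL1 : MeasurableSet (ballL1 J L) :=
  measurableSet_le continuous_sum_abs.measurable measurable_const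

theorem measurableSet_preimage_thetaJ : MeasurableSet (extendZero J ⁻¹' ThetaJ p L J) := by
  rw [preimage_extendZero_thetaJ]
  refine measurableSet_ballL1.inter ?_
  rw [Set.ofPred_forall]
  exact MeasurableSet.iInter fun j =>
    (measurableSet_eq_fun (measurable_pi_apply j) measurable_const).compl

theorem ae_forall_ne_zero : ∀ᵐ v : J → ℝ, ∀ j, v j ≠ 0 :=
  ae_all_iff.2 fun j => Measure.ae_eval_ne (μ := fun _ : J => (volume : Measure ℝ)) j 0

theorem volume_preimage_thetaJ_inter (V : Set (J → ℝ)) :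
    volume ((extendZero J ⁻¹' ThetaJ p L J) ∩ V) = volume (ballL1 J L ∩ V) := by
  refine measure_congr ?_
  filter_upwards [ae_forall_ne_zero (J := J)] with v hv
  rw [preimage_extendZero_thetaJ]
  refine propext ?_
  change (v ∈ (ballL1 J L ∩ {v | ∀ j, v j ≠ 0}) ∩ V) ↔ v ∈ ballL1 J L ∩ V
  simp only [Set.mem_inter_iff, Set.mem_ofPred_eq]
  tauto

theorem volume_ballL1_pos (hL : 0 < L) : 0 < volume (ballL1 J L) := by
  have ho : IsOpen {v : J → ℝ | ∑ j, |v j| < L} :=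
    isOpen_lt continuous_sum_abs continuous_const
  exact (ho.measure_pos volume ⟨0, by simpa using hL⟩).trans_le
    (measure_mono fun v (hv : ∑ j, |v j| < L) => (hv.le : ∑ j, |v j| ≤ L))

theorem volume_ballL1_ne_top (hL : 0 ≤ L) : volume (ballL1 J L) ≠ ⊤ := by
  refine ((measure_mono fun v hv => ?_).trans_lt
    (measure_closedBall_lt_top (x := (0 : J → ℝ)) (r := L))).ne
  rw [mem_closedBall_zero_iff, pi_norm_le_iff_of_nonneg hL]
  exact fun j => (Finset.single_le_sum (f := fun j => |v j|) (fun _ _ => abs_nonneg _)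
    (Finset.mem_univ j)).trans hv

theorem volume_preimage_thetaJ : volume (extendZero J ⁻¹' ThetaJ p L J) = volume (ballL1 J L) := by
  simpa using volume_preimage_thetaJ_inter (J := J) (L := L) Set.univ

theorem isProbabilityMeasure_priorJ (hL : 0 < L) : IsProbabilityMeasure (priorJ p L J) := by
  have : IsProbabilityMeasure
      ((volume : Measure (J → ℝ))[|extendZero J ⁻¹' ThetaJ p L J]) := by
    refine cond_isProbabilityMeasure_of_finite ?_ ?_ <;> rw [volume_preimage_thetaJ]
    · exact (volume_ballL1_pos hL).ne'
    · exact volume_ballL1_ne_top hL.le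
  exact Measure.isProbabilityMeasure_map measurable_extendZero.aemeasurable

theorem measurableSet_theta : MeasurableSet (Theta p L) :=
  measurableSet_le continuous_sum_abs.measurable measurable_const

theorem ae_priorJ_mem_theta : ∀ᵐ θ ∂(priorJ p L J), θ ∈ Theta p L := by
  rw [priorJ]
  refine (ae_map_iff (p := fun θ => θ ∈ Theta p L) measurable_extendZero.aemeasurable
    measurableSet_theta).2 ?_
  filter_upwards [ae_cond_mem measurableSet_preimage_thetaJ] with v hv using hv.1

/-- The uniform measure on `Θ_J` charges `ℓ¹` neighbourhoods of the points of `Θ_J`: the homothety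
with ratio `u` centred at the point maps the `ℓ¹` ball into the neighbourhood. -/
theorem le_priorJ_neighbourhood (hL : 0 < L) {θ₀ : Fin p → ℝ} (hθ₀ : θ₀ ∈ ThetaJ p L J) {u : ℝ}
    (hu : 0 < u) (hu1 : u ≤ 1) :
    ENNReal.ofReal (u ^ J.card) ≤ priorJ p L J {θ | ∑ j, |θ j - θ₀ j| ≤ 2 * L * u} := by
  set v₀ : J → ℝ := fun j => θ₀ j
  have hext : extendZero J v₀ = θ₀ := extendZero_restrict hθ₀
  have hv₀ : v₀ ∈ ballL1 J L := by
    have := hθ₀.1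
    rw [← hext, sum_extendZero (fun _ x => |x|) (by simp)] at this
    exact this
  have hVm : MeasurableSet {θ : Fin p → ℝ | ∑ j, |θ j - θ₀ j| ≤ 2 * L * u} :=
    measurableSet_le (continuous_finsetSum _ fun j _ =>
      ((continuous_apply j).sub continuous_const).abs).measurable measurable_const
  have hV : extendZero J ⁻¹' {θ | ∑ j, |θ j - θ₀ j| ≤ 2 * L * u} =
      {v | ∑ j, |v j - v₀ j| ≤ 2 * L * u} := by
    ext v
    simp only [Set.mem_preimage, Set.mem_ofPred_eq]
    have : ∑ j, |extendZero J v j - θ₀ j| = ∑ j : J, |v j - v₀ j| := by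
      have h := sum_extendZero (J := J) (fun _ x => |x|) (by simp) (fun j => v j - v₀ j)
      rw [← h, ← hext]
      refine Finset.sum_congr rfl fun j _ => ?_
      by_cases hj : j ∈ J <;> simp [extendZero, hj]
    rw [this]
  have himage : AffineMap.homothety v₀ u '' ballL1 J L ⊆
      ballL1 J L ∩ {v | ∑ j, |v j - v₀ j| ≤ 2 * L * u} := by
    rintro _ ⟨v, hv, rfl⟩
    simp only [ballL1, Set.mem_ofPred_eq] at hv hv₀
    simp only [AffineMap.homothety_apply, vsub_eq_sub, vadd_eq_add, ballL1, Set.mem_inter_iff,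
      Set.mem_ofPred_eq, Pi.add_apply, Pi.smul_apply, Pi.sub_apply, smul_eq_mul,
      add_sub_cancel_right]
    constructor
    · calc ∑ j, |u * (v j - v₀ j) + v₀ j| ≤ ∑ j, (u * |v j| + (1 - u) * |v₀ j|) := by
            refine Finset.sum_le_sum fun j _ => ?_
            have e : u * (v j - v₀ j) + v₀ j = u * v j + (1 - u) * v₀ j := by ring
            rw [e]
            refine (abs_add_le _ _).trans (le_of_eq ?_)
            rw [abs_mul, abs_mul, abs_of_pos hu, abs_of_nonneg (sub_nonneg.2 hu1)]
        _ = u * ∑ j, |v j| + (1 - u) * ∑ j, |v₀ j| := by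
            rw [Finset.sum_add_distrib, Finset.mul_sum, Finset.mul_sum]
        _ ≤ u * L + (1 - u) * L := by gcongr
        _ = L := by ring
    · calc ∑ j, |u * (v j - v₀ j)| ≤ ∑ j, u * (|v j| + |v₀ j|) := by
            refine Finset.sum_le_sum fun j _ => ?_
            rw [abs_mul, abs_of_pos hu]
            exact mul_le_mul_of_nonneg_left (abs_sub _ _) hu.le
        _ = u * (∑ j, |v j| + ∑ j, |v₀ j|) := by rw [← Finset.mul_sum, Finset.sum_add_distrib]
        _ ≤ u * (L + L) := by gcongr
        _ = 2 * L * u := by ring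
  have hvol := (Measure.addHaar_image_homothety volume v₀ u (ballL1 J L)).ge.trans
    (measure_mono himage)
  rw [Module.finrank_fintype_fun_eq_card, Fintype.card_coe, abs_of_pos (by positivity)] at hvol
  rw [priorJ, Measure.map_apply measurable_extendZero hVm,
    cond_apply measurableSet_preimage_thetaJ, volume_preimage_thetaJ_inter, volume_preimage_thetaJ,
    hV]
  calc ENNReal.ofReal (u ^ J.card)
      = (volume (ballL1 J L))⁻¹ * (ENNReal.ofReal (u ^ J.card) * volume (ballL1 J L)) := by
        rw [mul_comm (ENNReal.ofReal _), ← mul_assoc,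
          ENNReal.inv_mul_cancel (volume_ballL1_pos hL).ne' (volume_ballL1_ne_top hL.le), one_mul]
    _ ≤ _ := by gcongr

theorem weight_pos : 0 < weight p J := by
  have : 0 < p.choose J.card := Nat.choose_pos (by simpa using J.card_le_univ)
  unfold weight; positivity

theorem sum_weight_le_one : ∑ J : Finset (Fin p), weight p J ≤ 1 := by
  have h := Finset.sum_powerset_apply_card
    (fun m => (2 : ℝ) ^ (-(m : ℤ) - 1) * ((p.choose m : ℝ))⁻¹) (x := (Finset.univ : Finset (Fin p)))
  rw [Finset.powerset_univ, Finset.card_univ, Fintype.card_fin] at h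
  have hterm : ∀ m ∈ Finset.range (p + 1),
      p.choose m • ((2 : ℝ) ^ (-(m : ℤ) - 1) * ((p.choose m : ℝ))⁻¹) = (1 / 2) ^ m * (1 / 2) := by
    intro m hm
    have : (0 : ℝ) < p.choose m := by
      exact_mod_cast Nat.choose_pos (Nat.lt_succ_iff.1 (Finset.mem_range.1 hm))
    rw [nsmul_eq_mul, mul_comm ((2 : ℝ) ^ _), ← mul_assoc, mul_inv_cancel₀ this.ne', one_mul,
      zpow_sub₀ two_ne_zero, zpow_neg, zpow_natCast, zpow_one, one_div, inv_pow, div_eq_mul_inv]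
  calc ∑ J : Finset (Fin p), weight p J
      = ∑ m ∈ Finset.range (p + 1), ((1 / 2 : ℝ)) ^ m * (1 / 2) := by
        rw [← Finset.sum_congr rfl hterm, ← h]; rfl
    _ ≤ 1 := by
        rw [← Finset.sum_mul]
        have := sum_geometric_two_le (p + 1)
        linarith

theorem prior_univ_le_one (hL : 0 < L) : prior p L Set.univ ≤ 1 := by
  have : ∀ J, IsProbabilityMeasure (priorJ p L J) := fun J => isProbabilityMeasure_priorJ hL
  rw [prior, Measure.coe_finsetSum, Finset.sum_apply]
  simp only [Measure.smul_apply, measure_univ, smul_eq_mul, mul_one]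
  rw [← ENNReal.ofReal_sum_of_nonneg fun J _ => weight_pos.le]
  exact ENNReal.ofReal_le_one.2 sum_weight_le_one

theorem isFiniteMeasure_prior (hL : 0 < L) : IsFiniteMeasure (prior p L) :=
  ⟨(prior_univ_le_one hL).trans_lt ENNReal.one_lt_top⟩

theorem smul_priorJ_le_prior (J : Finset (Fin p)) (V : Set (Fin p → ℝ)) :
    ENNReal.ofReal (weight p J) * priorJ p L J V ≤ prior p L V := by
  rw [prior, Measure.coe_finsetSum, Finset.sum_apply]
  exact Finset.single_le_sum (f := fun J => (ENNReal.ofReal (weight p J) • priorJ p L J) V)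
    (fun _ _ => zero_le) (Finset.mem_univ J)

theorem prior_ne_zero (hL : 0 < L) : prior p L ≠ 0 := by
  intro h
  have : IsProbabilityMeasure (priorJ p L ∅) := isProbabilityMeasure_priorJ hL
  have h1 := smul_priorJ_le_prior (L := L) (∅ : Finset (Fin p)) Set.univ
  rw [h, measure_univ, mul_one] at h1
  simp only [Measure.coe_zero, Pi.zero_apply, nonpos_iff_eq_zero, ENNReal.ofReal_eq_zero] at h1
  exact absurd h1 (not_le.2 weight_pos)

theorem ae_prior_mem_theta : ∀ᵐ θ ∂(prior p L), θ ∈ Theta p L := by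
  rw [prior, ae_iff, Measure.coe_finsetSum, Finset.sum_apply]
  refine Finset.sum_eq_zero fun J _ => ?_
  rw [Measure.smul_apply, ae_iff.1 ae_priorJ_mem_theta, smul_zero]

theorem le_prior_neighbourhood (hL : 0 < L) {θ₀ : Fin p → ℝ} (hθ₀ : θ₀ ∈ ThetaJ p L J) {u : ℝ}
    (hu : 0 < u) (hu1 : u ≤ 1) :
    weight p J * u ^ J.card ≤ (prior p L).real {θ | ∑ j, |θ j - θ₀ j| ≤ 2 * L * u} := by
  have := isFiniteMeasure_prior (p := p) hL
  refine (ENNReal.ofReal_le_iff_le_toReal (measure_ne_top _ _)).1 ?_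
  rw [ENNReal.ofReal_mul weight_pos.le]
  exact (mul_le_mul_right (le_priorJ_neighbourhood hL hθ₀ hu hu1) _).trans
    (smul_priorJ_le_prior J _)

theorem nonempty_thetaJ (hL : 0 < L) : (ThetaJ p L J).Nonempty := by
  have h := (volume_ballL1_pos (J := J) hL).ne'
  rw [← volume_preimage_thetaJ] at h
  obtain ⟨v, hv⟩ := nonempty_of_measure_ne_zero h
  exact ⟨_, hv⟩

/-- The binomial coefficient in the weight is at most `(e p / |J|) ^ |J|`. -/
theorem neg_log_weight_le : -Real.log (weight p J) ≤
    (J.card + 1) * Real.log 2 + J.card + J.card * Real.log (p / J.card) := by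
  have hJp : J.card ≤ p := by simpa using J.card_le_univ
  have hch : (0 : ℝ) < p.choose J.card := by exact_mod_cast Nat.choose_pos hJp
  rw [weight, Real.log_mul (by positivity) (by positivity), Real.log_zpow, Real.log_inv]
  have hb : Real.log (p.choose J.card) ≤ J.card + J.card * Real.log (p / J.card) := by
    rcases Nat.eq_zero_or_pos J.card with h0 | h0
    · simp [h0]
    have hj : (0 : ℝ) < J.card := by exact_mod_cast h0
    have hp : (0 : ℝ) < p := by exact_mod_cast h0.trans_le hJp
    have h1 : (p.choose J.card : ℝ) ≤ p ^ J.card / (J.card.factorial : ℝ) :=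
      Nat.choose_le_pow_div _ _
    have h2 := Real.pow_div_factorial_le_exp (J.card : ℝ) hj.le J.card
    have h3 : (p.choose J.card : ℝ) ≤ Real.exp J.card * ((p : ℝ) / J.card) ^ J.card := by
      calc (p.choose J.card : ℝ) ≤ p ^ J.card / (J.card.factorial : ℝ) := h1
        _ = ((J.card : ℝ) ^ J.card / J.card.factorial) * ((p : ℝ) / J.card) ^ J.card := by
            rw [div_pow]; field_simp
        _ ≤ _ := by gcongr
    calc Real.log (p.choose J.card) ≤ Real.log (Real.exp J.card * ((p : ℝ) / J.card) ^ J.card) :=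
          Real.log_le_log hch h3
      _ = _ := by rw [Real.log_mul (by positivity) (by positivity), Real.log_exp, Real.log_pow]
  push_cast
  linarith

end Prior

/-! ### The Gibbs estimator -/

section Gibbs

variable {Ω : Type*} {X : ℤ → Ω → ℝ} {B C L : ℝ} {p : ℕ}

theorem convex_theta : Convex ℝ (Theta p L) := by
  intro x hx y hy a b ha hb hab
  change ∑ j, |a * x j + b * y j| ≤ L
  calc ∑ j, |a * x j + b * y j| ≤ ∑ j, (a * |x j| + b * |y j|) := by
        refine Finset.sum_le_sum fun j _ => (abs_add_le _ _).trans (le_of_eq ?_)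
        rw [abs_mul, abs_mul, abs_of_nonneg ha, abs_of_nonneg hb]
    _ = a * ∑ j, |x j| + b * ∑ j, |y j| := by
        rw [Finset.sum_add_distrib, Finset.mul_sum, Finset.mul_sum]
    _ ≤ a * L + b * L :=
        add_le_add (mul_le_mul_of_nonneg_left hx ha) (mul_le_mul_of_nonneg_left hy hb)
    _ = L := by rw [← add_mul, hab, one_mul]

theorem isClosed_theta : IsClosed (Theta p L) :=
  isClosed_le continuous_sum_abs continuous_const

theorem empRisk_nonneg {n k : ℕ} (hkn : k < n) (θ : Fin p → ℝ) (ω : Ω) :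
    0 ≤ empRisk X n k θ ω := by
  have : (k : ℝ) < n := by exact_mod_cast hkn
  exact mul_nonneg (inv_nonneg.2 (sub_nonneg.2 this.le)) (Finset.sum_nonneg fun _ _ => sq_nonneg _)

theorem continuous_empRisk (n k : ℕ) (ω : Ω) :
    Continuous fun θ : Fin p → ℝ => empRisk X n k θ ω := by
  unfold empRisk predictor; fun_prop

/-- The empirical risk is Lipschitz on the `ℓ¹` ball. -/
theorem empRisk_sub_le (hb : ∀ t ω, |X t ω| ≤ B) (hB : 0 ≤ B) {n k : ℕ} (hkn : k < n)
    {θ θ' : Fin p → ℝ} (hθ : θ ∈ Theta p L) (hθ' : θ' ∈ Theta p L) {η : ℝ}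
    (hη : ∑ j, |θ j - θ' j| ≤ η) (ω : Ω) :
    empRisk X n k θ ω - empRisk X n k θ' ω ≤ 2 * (1 + L) * B ^ 2 * η := by
  have hN : (0 : ℝ) < (n : ℝ) - k := sub_pos.2 (by exact_mod_cast hkn)
  have hterm : ∀ t : ℤ, lossDiff X θ θ' t ω ≤ 2 * (1 + L) * B ^ 2 * η := by
    intro t
    have h1 : |predictor X θ t ω - predictor X θ' t ω| ≤ η * B := by
      have e : predictor X θ t ω - predictor X θ' t ω = predictor X (fun j => θ j - θ' j) t ω := by
        simp only [predictor, sub_mul, Finset.sum_sub_distrib]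
      rw [e]
      exact (abs_predictor_le_sum hb hB _ t ω).trans (mul_le_mul_of_nonneg_right hη hB)
    have h2 := abs_predictor_sub_le hb hθ hB t ω
    have h3 := abs_predictor_sub_le hb hθ' hB t ω
    have h4 : |predictor X θ t ω + predictor X θ' t ω - 2 * X t ω| ≤ 2 * ((1 + L) * B) := by
      rw [abs_le] at h2 h3 ⊢; constructor <;> linarith
    calc lossDiff X θ θ' t ω = (predictor X θ t ω - predictor X θ' t ω) *
          (predictor X θ t ω + predictor X θ' t ω - 2 * X t ω) := by rw [lossDiff]; ring
      _ ≤ |predictor X θ t ω - predictor X θ' t ω| *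
          |predictor X θ t ω + predictor X θ' t ω - 2 * X t ω| := by
          rw [← abs_mul]; exact le_abs_self _
      _ ≤ (η * B) * (2 * ((1 + L) * B)) :=
          mul_le_mul h1 h4 (abs_nonneg _) ((abs_nonneg _).trans h1)
      _ = _ := by ring
  rw [empRisk_sub_empRisk hkn, inv_mul_le_iff₀ hN]
  calc _ ≤ ∑ _l ∈ Finset.range (n - k), 2 * (1 + L) * B ^ 2 * η :=
        Finset.sum_le_sum fun l _ => hterm _
    _ = _ := by
        rw [Finset.sum_const, Finset.card_range, nsmul_eq_mul, Nat.cast_sub hkn.le]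

theorem abs_empRisk_sub_le (hb : ∀ t ω, |X t ω| ≤ B) (hB : 0 ≤ B) {n k : ℕ} (hkn : k < n)
    {θ θ' : Fin p → ℝ} (hθ : θ ∈ Theta p L) (hθ' : θ' ∈ Theta p L) (ω : Ω) :
    |empRisk X n k θ ω - empRisk X n k θ' ω| ≤ ((1 + L) * B) ^ 2 := by
  have hN : (0 : ℝ) < (n : ℝ) - k := sub_pos.2 (by exact_mod_cast hkn)
  rw [empRisk_sub_empRisk hkn, abs_mul, abs_of_pos (inv_pos.2 hN), inv_mul_le_iff₀ hN]
  refine (Finset.abs_sum_le_sum_abs _ _).trans ((Finset.sum_le_sum fun l _ =>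
    abs_lossDiff_le hb hB hθ hθ' _ ω).trans (le_of_eq ?_))
  rw [Finset.sum_const, Finset.card_range, nsmul_eq_mul, Nat.cast_sub hkn.le]

theorem norm_le_of_mem_theta (hL : 0 ≤ L) {θ : Fin p → ℝ} (hθ : θ ∈ Theta p L) : ‖θ‖ ≤ L := by
  rw [pi_norm_le_iff_of_nonneg hL]
  exact fun j => (Finset.single_le_sum (f := fun j => |θ j|) (fun _ _ => abs_nonneg _)
    (Finset.mem_univ j)).trans hθ

theorem integrable_exp_neg_empRisk (hL : 0 < L) {n k : ℕ} (hkn : k < n) {lam : ℝ} (hlam : 0 < lam)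
    (ω : Ω) : Integrable (fun θ => Real.exp (-lam * empRisk X n k θ ω)) (prior p L) := by
  have := isFiniteMeasure_prior (p := p) hL
  refine Integrable.of_bound ((continuous_const.mul (continuous_empRisk n k ω)).rexp.measurable
    |>.aestronglyMeasurable) 1 (.of_forall fun θ => ?_)
  rw [Real.norm_eq_abs, Real.abs_exp, Real.exp_le_one_iff]
  have := mul_nonneg hlam.le (empRisk_nonneg (X := X) hkn θ ω)
  linarith

theorem isProbabilityMeasure_gibbsMeasure (hL : 0 < L) {n k : ℕ} (hkn : k < n) {lam : ℝ}
    (hlam : 0 < lam) (ω : Ω) : IsProbabilityMeasure (gibbsMeasure p L X n k lam ω) := by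
  have : NeZero (prior p L) := ⟨prior_ne_zero hL⟩
  exact isProbabilityMeasure_tilted (integrable_exp_neg_empRisk hL hkn hlam ω)

theorem ae_gibbsMeasure_mem_theta {n k : ℕ} {lam : ℝ} (ω : Ω) :
    ∀ᵐ θ ∂(gibbsMeasure p L X n k lam ω), θ ∈ Theta p L :=
  (tilted_absolutelyContinuous _ _).ae_le ae_prior_mem_theta

theorem integrable_id_gibbsMeasure (hL : 0 < L) {n k : ℕ} (hkn : k < n) {lam : ℝ}
    (hlam : 0 < lam) (ω : Ω) : Integrable (fun θ => θ) (gibbsMeasure p L X n k lam ω) := by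
  have := isProbabilityMeasure_gibbsMeasure (p := p) (X := X) hL hkn hlam ω
  refine Integrable.of_bound measurable_id.aestronglyMeasurable L ?_
  filter_upwards [ae_gibbsMeasure_mem_theta ω] with θ hθ using norm_le_of_mem_theta hL.le hθ

theorem gibbsEstimator_mem_theta (hL : 0 < L) {n k : ℕ} (hkn : k < n) {lam : ℝ}
    (hlam : 0 < lam) (ω : Ω) : gibbsEstimator p L X n k lam ω ∈ Theta p L := by
  have := isProbabilityMeasure_gibbsMeasure (p := p) (X := X) hL hkn hlam ω
  exact convex_theta.integral_mem isClosed_theta (ae_gibbsMeasure_mem_theta ω)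
    (integrable_id_gibbsMeasure hL hkn hlam ω)

/-- Jensen's inequality for the Gibbs measure, cleared of the normalising constant. The offset `c`
is arbitrary because it cancels in the Gibbs measure. -/
theorem exp_mul_integral_le (hL : 0 < L) {n k : ℕ} (hkn : k < n) {lam : ℝ} (hlam : 0 < lam) (ω : Ω)
    {f : (Fin p → ℝ) → ℝ} (hf : ConvexOn ℝ Set.univ f) {K : ℝ} (hK : ∀ θ ∈ Theta p L, f θ ≤ K)
    (c : ℝ) :
    Real.exp (f (gibbsEstimator p L X n k lam ω)) *
        ∫ θ, Real.exp (-lam * (empRisk X n k θ ω - c)) ∂(prior p L) ≤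
      ∫ θ, Real.exp (f θ - lam * (empRisk X n k θ ω - c)) ∂(prior p L) := by
  have := isProbabilityMeasure_gibbsMeasure (p := p) (X := X) hL hkn hlam ω
  have : NeZero (prior p L) := ⟨prior_ne_zero hL⟩
  have hfc : Continuous f := hf.locallyLipschitz.continuous
  have hG : ConvexOn ℝ Set.univ fun θ => Real.exp (f θ) := by
    refine ⟨convex_univ, fun x _ y _ a b ha hb hab => ?_⟩
    exact (Real.exp_le_exp.2 (hf.2 (Set.mem_univ x) (Set.mem_univ y) ha hb hab)).trans
      (convexOn_exp.2 (Set.mem_univ _) (Set.mem_univ _) ha hb hab)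
  have hint : Integrable (fun θ => Real.exp (f θ)) (gibbsMeasure p L X n k lam ω) := by
    refine Integrable.of_bound hfc.rexp.measurable.aestronglyMeasurable (Real.exp K) ?_
    filter_upwards [ae_gibbsMeasure_mem_theta ω] with θ hθ
    rw [Real.norm_eq_abs, Real.abs_exp]
    exact Real.exp_le_exp.2 (hK θ hθ)
  have hJ := hG.map_integral_le hfc.rexp.continuousOn isClosed_univ
    (.of_forall fun _ => Set.mem_univ _)
    (integrable_id_gibbsMeasure hL hkn hlam ω) hint
  set Z := ∫ θ, Real.exp (-lam * empRisk X n k θ ω) ∂(prior p L)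
  have hZ : 0 < Z := integral_exp_pos (integrable_exp_neg_empRisk hL hkn hlam ω)
  have e1 : ∫ θ, Real.exp (f θ) ∂(gibbsMeasure p L X n k lam ω) =
      Z⁻¹ * ∫ θ, Real.exp (f θ - lam * empRisk X n k θ ω) ∂(prior p L) := by
    rw [gibbsMeasure, integral_tilted, ← integral_const_mul]
    refine integral_congr_ae (.of_forall fun θ => ?_)
    simp only [smul_eq_mul]
    rw [sub_eq_add_neg, Real.exp_add, ← neg_mul]
    ring
  have e2 : ∫ θ, Real.exp (-lam * (empRisk X n k θ ω - c)) ∂(prior p L) =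
      Real.exp (lam * c) * Z := by
    rw [← integral_const_mul]
    refine integral_congr_ae (.of_forall fun θ => ?_)
    simp only [← Real.exp_add]; congr 1; ring
  have e3 : ∫ θ, Real.exp (f θ - lam * (empRisk X n k θ ω - c)) ∂(prior p L) =
      Real.exp (lam * c) * ∫ θ, Real.exp (f θ - lam * empRisk X n k θ ω) ∂(prior p L) := by
    rw [← integral_const_mul]
    refine integral_congr_ae (.of_forall fun θ => ?_)
    simp only [← Real.exp_add]; congr 1; ring
  rw [e1] at hJ
  rw [e2, e3]
  have h := mul_le_mul_of_nonneg_right hJ (mul_pos (Real.exp_pos (lam * c)) hZ).le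
  refine h.trans (le_of_eq ?_)
  field_simp

/-- Lower bound for the partition function, from the parameters near a point of a model. -/
theorem le_integral_exp_neg_empRisk (hb : ∀ t ω, |X t ω| ≤ B) (hB : 0 ≤ B) (hL : 0 < L) {n k : ℕ}
    (hkn : k < n) {lam : ℝ} (hlam : 0 < lam) (ω : Ω) {J : Finset (Fin p)} {θ₀ : Fin p → ℝ}
    (hθ₀ : θ₀ ∈ ThetaJ p L J) {u : ℝ} (hu : 0 < u) (hu1 : u ≤ 1) (c : ℝ) :
    weight p J * u ^ J.card *
        Real.exp (-lam * (empRisk X n k θ₀ ω - c + 4 * L * (1 + L) * B ^ 2 * u)) ≤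
      ∫ θ, Real.exp (-lam * (empRisk X n k θ ω - c)) ∂(prior p L) := by
  have := isFiniteMeasure_prior (p := p) hL
  set V : Set (Fin p → ℝ) := {θ | ∑ j, |θ j - θ₀ j| ≤ 2 * L * u}
  have hVm : MeasurableSet V :=
    measurableSet_le (continuous_finsetSum _ fun j _ =>
      ((continuous_apply j).sub continuous_const).abs).measurable measurable_const
  have hint : Integrable (fun θ => Real.exp (-lam * (empRisk X n k θ ω - c))) (prior p L) := by
    refine ((integrable_exp_neg_empRisk (X := X) hL hkn hlam ω).const_mul
      (Real.exp (lam * c))).congr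
      (.of_forall fun θ => ?_)
    simp only [← Real.exp_add]; congr 1; ring
  set a := Real.exp (-lam * (empRisk X n k θ₀ ω - c + 4 * L * (1 + L) * B ^ 2 * u))
  calc weight p J * u ^ J.card * a ≤ (prior p L).real V * a :=
        mul_le_mul_of_nonneg_right (le_prior_neighbourhood hL hθ₀ hu hu1) (Real.exp_pos _).le
    _ = ∫ _θ in V, a ∂(prior p L) := by simp
    _ ≤ ∫ θ in V, Real.exp (-lam * (empRisk X n k θ ω - c)) ∂(prior p L) := by
        refine setIntegral_mono_on_ae (integrable_const a) hint.integrableOn hVm ?_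
        filter_upwards [ae_prior_mem_theta] with θ hθ hθV
        have := empRisk_sub_le hb hB hkn hθ hθ₀.1 hθV ω
        refine Real.exp_le_exp.2 ?_
        rw [neg_mul, neg_mul, neg_le_neg_iff]
        refine mul_le_mul_of_nonneg_left ?_ hlam.le
        linarith
    _ ≤ _ := setIntegral_le_integral hint (.of_forall fun θ => (Real.exp_pos _).le)

end Gibbs

section Oracle

variable {Ω : Type*} [MeasurableSpace Ω] {μ : Measure Ω} [IsProbabilityMeasure μ]
  {X : ℤ → Ω → ℝ} {B C L : ℝ} {p : ℕ}

theorem convexOn_risk (hX : ∀ t, Measurable (X t)) (hb : ∀ t ω, |X t ω| ≤ B) (hB : 0 ≤ B) :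
    ConvexOn ℝ Set.univ (risk (p := p) μ X) := by
  refine ⟨convex_univ, fun x _ y _ a b ha hb' hab => ?_⟩
  have hi := integrable_sq_residual (μ := μ) (p := p) hX hb hB
  rw [smul_eq_mul, smul_eq_mul, risk, risk, risk, ← integral_const_mul, ← integral_const_mul,
    ← integral_add ((hi x 0).const_mul _) ((hi y 0).const_mul _)]
  refine integral_mono (hi _ 0) (((hi x 0).const_mul _).add ((hi y 0).const_mul _)) fun ω => ?_
  simp only [predictor_add_smul]
  have hb1 : b = 1 - a := by linarith
  subst hb1
  nlinarith [mul_nonneg (mul_nonneg ha hb') (sq_nonneg (predictor X x 0 ω - predictor X y 0 ω))]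

theorem measurable_empRisk_uncurry (hX : ∀ t, Measurable (X t)) (n k : ℕ) :
    Measurable fun z : Ω × (Fin p → ℝ) => empRisk X n k z.2 z.1 := by
  have hcoord : ∀ t : ℤ, Measurable fun z : Ω × (Fin p → ℝ) => X t z.1 := fun t =>
    (hX t).comp measurable_fst
  have hparam : ∀ j, Measurable fun z : Ω × (Fin p → ℝ) => z.2 j := fun j =>
    (measurable_pi_apply j).comp measurable_snd
  have hpred : ∀ t : ℤ, Measurable fun z : Ω × (Fin p → ℝ) => predictor X z.2 t z.1 := fun t =>
    Finset.measurable_sum _ fun j _ => (hparam j).mul (hcoord _)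
  have hterm : ∀ t : ℤ, Measurable fun z : Ω × (Fin p → ℝ) =>
      (predictor X z.2 t z.1 - X t z.1) ^ 2 := fun t => ((hpred t).sub (hcoord t)).pow_const 2
  have hsum : Measurable fun z : Ω × (Fin p → ℝ) => ∑ i ∈ Finset.Icc (k + 1) n,
      (predictor X z.2 (i : ℤ) z.1 - X (i : ℤ) z.1) ^ 2 :=
    Finset.measurable_sum _ fun i _ => hterm i
  exact hsum.const_mul ((n : ℝ) - k)⁻¹

theorem measurable_empRisk (hX : ∀ t, Measurable (X t)) (n k : ℕ) (θ : Fin p → ℝ) :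
    Measurable (empRisk X n k θ) := by
  have hsum : Measurable fun ω => ∑ i ∈ Finset.Icc (k + 1) n,
      (predictor X θ (i : ℤ) ω - X (i : ℤ) ω) ^ 2 :=
    Finset.measurable_sum _ fun i _ =>
      ((measurable_predictor (fun s _ _ => hX s) θ).sub (hX _)).pow_const 2
  exact hsum.const_mul ((n : ℝ) - k)⁻¹

/-- With high probability the integral of the exponential deviation over the prior is bounded. The
conclusion bounds the measure of the exceptional set. -/
theorem measure_integral_exp_ge_le (hX : ∀ t, Measurable (X t)) (hst : IsStationary μ X)
    (hb : ∀ t ω, |X t ω| ≤ B) (hB : 0 < B) (hL : 0 < L) (hmix : PhiMix μ X C)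
    {θbar : Fin p → ℝ} (hθbar : θbar ∈ Theta p L)
    (hmin : ∀ θ : Fin p → ℝ, risk μ X θbar ≤ risk μ X θ) {n k : ℕ} (hp : 1 ≤ p) (hpk : p ≤ k)
    (hkn : k < n) {c₀ : ℝ} (hc : 128 * C * ((1 + L) * B) ^ 2 ≤ c₀) {ε : ℝ} (hε : 0 < ε) :
    μ {ω | 2 / ε < ∫ θ, Real.exp (((n : ℝ) - k) / (c₀ * k) * (risk μ X θ - risk μ X θbar) / 2 -
      ((n : ℝ) - k) / (c₀ * k) * (empRisk X n k θ ω - empRisk X n k θbar ω)) ∂(prior p L)} ≤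
      ENNReal.ofReal (ε / 2) := by
  have := isFiniteMeasure_prior (p := p) hL
  set lam := ((n : ℝ) - k) / (c₀ * k)
  have hriskc : Continuous (risk (p := p) μ X) :=
    (convexOn_risk hX hb hB.le).locallyLipschitz.continuous
  set F : Ω → (Fin p → ℝ) → ℝ := fun ω θ => Real.exp (lam * (risk μ X θ - risk μ X θbar) / 2 -
    lam * (empRisk X n k θ ω - empRisk X n k θbar ω))
  have hF : Measurable (Function.uncurry F) := by
    refine Real.measurable_exp.comp (Measurable.sub ?_ ?_)
    · exact (((hriskc.measurable.comp measurable_snd).sub_const _).const_mul _).div_const _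
    · exact ((measurable_empRisk_uncurry hX n k).sub
        ((measurable_empRisk hX n k θbar).comp measurable_fst)).const_mul _
  have hF' : Measurable (Function.uncurry fun ω θ => ENNReal.ofReal (F ω θ)) := hF.ennreal_ofReal
  have hone : ∀ θ ∈ Theta p L, ∫⁻ ω, ENNReal.ofReal (F ω θ) ∂μ ≤ 1 := by
    intro θ hθ
    have h := integral_exp_empRisk_le hX hst hb hB hL hmix hθ hθbar hmin hp hpk hkn hc
      (σ := -1) (by simp)
    have hFm : Measurable fun ω => F ω θ := hF.of_uncurry_right
    have hbd : ∀ ω, |F ω θ| ≤ Real.exp (lam * (risk μ X θ - risk μ X θbar) / 2 +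
        |lam| * ((1 + L) * B) ^ 2) := fun ω => by
      rw [Real.abs_exp]
      refine Real.exp_le_exp.2 ?_
      have h1 := abs_empRisk_sub_le hb hB.le hkn hθ hθbar ω
      have h2 : -(lam * (empRisk X n k θ ω - empRisk X n k θbar ω)) ≤
          |lam| * ((1 + L) * B) ^ 2 :=
        (neg_le_abs _).trans (by rw [abs_mul]; exact mul_le_mul_of_nonneg_left h1 (abs_nonneg _))
      linarith
    rw [← ofReal_integral_eq_lintegral_ofReal
      (Integrable.of_bound hFm.aestronglyMeasurable _ (.of_forall hbd))
      (.of_forall fun ω => (Real.exp_pos _).le), ENNReal.ofReal_le_one]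
    have e : ∀ ω, F ω θ = Real.exp (-(lam * (risk μ X θ - risk μ X θbar) / 2)) *
        Real.exp (-1 * lam * (empRisk X n k θ ω - empRisk X n k θbar ω -
          (risk μ X θ - risk μ X θbar))) := fun ω => by
      simp only [F, ← Real.exp_add]; congr 1; ring
    simp_rw [e]
    rw [integral_const_mul]
    refine (mul_le_mul_of_nonneg_left h (Real.exp_pos _).le).trans (le_of_eq ?_)
    rw [← Real.exp_add, neg_add_cancel, Real.exp_zero]
  have htot : ∫⁻ ω, ∫⁻ θ, ENNReal.ofReal (F ω θ) ∂(prior p L) ∂μ ≤ 1 := by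
    rw [lintegral_lintegral_swap hF'.aemeasurable]
    calc ∫⁻ θ, ∫⁻ ω, ENNReal.ofReal (F ω θ) ∂μ ∂(prior p L) ≤ ∫⁻ _θ, 1 ∂(prior p L) := by
          refine lintegral_mono_ae ?_
          filter_upwards [ae_prior_mem_theta] with θ hθ using hone θ hθ
      _ ≤ 1 := by simpa using prior_univ_le_one hL
  have hpos : (0 : ℝ) < 2 / ε := by positivity
  calc μ {ω | 2 / ε < ∫ θ, F ω θ ∂(prior p L)}
      ≤ μ {ω | ENNReal.ofReal (2 / ε) ≤ ∫⁻ θ, ENNReal.ofReal (F ω θ) ∂(prior p L)} := by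
        refine measure_mono fun ω (hω : 2 / ε < ∫ θ, F ω θ ∂(prior p L)) => ?_
        -- A nonzero Bochner integral comes from an integrable function.
        have hi : Integrable (F ω) (prior p L) := by
          by_contra h
          rw [integral_undef h] at hω
          linarith
        change ENNReal.ofReal (2 / ε) ≤ ∫⁻ θ, ENNReal.ofReal (F ω θ) ∂(prior p L)
        rw [← ofReal_integral_eq_lintegral_ofReal hi (.of_forall fun θ => (Real.exp_pos _).le)]
        exact ENNReal.ofReal_le_ofReal hω.le
    _ ≤ (∫⁻ ω, ∫⁻ θ, ENNReal.ofReal (F ω θ) ∂(prior p L) ∂μ) / ENNReal.ofReal (2 / ε) :=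
        meas_ge_le_lintegral_div hF'.lintegral_prod_right'.aemeasurable
          (ENNReal.ofReal_pos.2 hpos).ne' ENNReal.ofReal_ne_top
    _ ≤ 1 / ENNReal.ofReal (2 / ε) := by gcongr
    _ = ENNReal.ofReal (ε / 2) := by
        rw [one_div, ← ENNReal.ofReal_inv_of_pos hpos, inv_div]

/-- The exceptional set of the deviation bound at a single parameter. -/
theorem measure_exp_empRisk_ge_le (hX : ∀ t, Measurable (X t)) (hst : IsStationary μ X)
    (hb : ∀ t ω, |X t ω| ≤ B) (hB : 0 < B) (hL : 0 < L) (hmix : PhiMix μ X C)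
    {θ θbar : Fin p → ℝ} (hθ : θ ∈ Theta p L) (hθbar : θbar ∈ Theta p L)
    (hmin : ∀ θ : Fin p → ℝ, risk μ X θbar ≤ risk μ X θ) {n k : ℕ} (hp : 1 ≤ p) (hpk : p ≤ k)
    (hkn : k < n) {c₀ : ℝ} (hc : 128 * C * ((1 + L) * B) ^ 2 ≤ c₀) {ε : ℝ} (hε : 0 < ε) :
    μ {ω | Real.log (2 / ε) + 3 / 2 * (((n : ℝ) - k) / (c₀ * k) * (risk μ X θ - risk μ X θbar)) <
      ((n : ℝ) - k) / (c₀ * k) * (empRisk X n k θ ω - empRisk X n k θbar ω)} ≤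
      ENNReal.ofReal (ε / 2) := by
  have h := integral_exp_empRisk_le hX hst hb hB hL hmix hθ hθbar hmin hp hpk hkn hc
    (σ := 1) (by simp)
  set lam := ((n : ℝ) - k) / (c₀ * k)
  set D := risk μ X θ - risk μ X θbar
  set Y : Ω → ℝ := fun ω => Real.exp (1 * lam * (empRisk X n k θ ω - empRisk X n k θbar ω - D))
  have hYm : Measurable Y := Real.measurable_exp.comp
    ((((measurable_empRisk hX n k θ).sub (measurable_empRisk hX n k θbar)).sub_const _).const_mul _)
  have hpos : (0 : ℝ) < 2 / ε := by positivity
  have hYi : Integrable Y μ := by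
    refine Integrable.of_bound hYm.aestronglyMeasurable
      (Real.exp (|1 * lam| * (((1 + L) * B) ^ 2 + |D|))) (.of_forall fun ω => ?_)
    rw [Real.norm_eq_abs, Real.abs_exp]
    refine Real.exp_le_exp.2 ((le_abs_self _).trans ?_)
    rw [abs_mul]
    exact mul_le_mul_of_nonneg_left ((abs_sub _ _).trans
      (add_le_add_left (abs_empRisk_sub_le hb hB.le hkn hθ hθbar ω) _)) (abs_nonneg _)
  have hM := mul_meas_ge_le_integral_of_nonneg (.of_forall fun ω => (Real.exp_pos _).le) hYi
    (2 / ε * Real.exp (lam * D / 2))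
  have hM' : μ.real {ω | 2 / ε * Real.exp (lam * D / 2) ≤ Y ω} ≤ ε / 2 := by
    have := hM.trans h
    have h1 : 2 / ε * μ.real {ω | 2 / ε * Real.exp (lam * D / 2) ≤ Y ω} ≤ 1 := by
      refine le_of_mul_le_mul_right ?_ (Real.exp_pos (lam * D / 2))
      linarith
    rw [div_mul_eq_mul_div, div_le_one hε] at h1
    linarith
  refine (measure_mono fun ω hω => ?_).trans
    ((ENNReal.le_ofReal_iff_toReal_le (measure_ne_top _ _) (by positivity)).2 hM')
  change Real.log (2 / ε) + 3 / 2 * (lam * D) < _ at hω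
  change 2 / ε * Real.exp (lam * D / 2) ≤ Real.exp _
  rw [← Real.exp_log hpos, ← Real.exp_add]
  exact Real.exp_le_exp.2 (by linarith)

end Oracle

/-! ### The oracle inequality -/

section Penalty

variable {p : ℕ} {J : Finset (Fin p)}

theorem card_mul_log_nonneg {N : ℝ} (hN : 1 ≤ N) :
    0 ≤ (J.card : ℝ) * Real.log (N * p / J.card) := by
  rcases Nat.eq_zero_or_pos J.card with h0 | h0
  · simp [h0]
  have hJp : (J.card : ℝ) ≤ p := by exact_mod_cast (by simpa using J.card_le_univ : J.card ≤ p)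
  have hj : (0 : ℝ) < J.card := by exact_mod_cast h0
  refine mul_nonneg hj.le (Real.log_nonneg ?_)
  rw [one_le_div hj]
  nlinarith

/-- The price of a model: the prior weight together with the volume of a neighbourhood of relative
size `1 / N`. -/
theorem neg_log_weight_add_le {N : ℝ} (hN : 2 ≤ N) :
    -Real.log (weight p J) + J.card * Real.log N ≤
      Real.log 2 + 4 * ((J.card : ℝ) * Real.log (N * p / J.card)) := by
  have hw := neg_log_weight_le (J := J)
  rcases Nat.eq_zero_or_pos J.card with h0 | h0
  · simp only [h0, Nat.cast_zero] at hw ⊢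
    linarith
  have hJp : (J.card : ℝ) ≤ p := by exact_mod_cast (by simpa using J.card_le_univ : J.card ≤ p)
  have hj : (0 : ℝ) < J.card := by exact_mod_cast h0
  have hpj : 0 ≤ Real.log (p / J.card) := Real.log_nonneg ((one_le_div hj).2 hJp)
  have hsplit : Real.log (N * p / J.card) = Real.log N + Real.log (p / J.card) := by
    rw [mul_div_assoc, Real.log_mul (by positivity) (by have := hj.trans_le hJp; positivity)]
  have h2N : Real.log 2 ≤ Real.log N := Real.log_le_log two_pos hN
  have h2 := Real.log_two_gt_d9
  rw [hsplit]
  nlinarith [mul_nonneg hj.le hpj, mul_le_mul_of_nonneg_left h2N hj.le]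

end Penalty

section Bounded

variable {Ω : Type*} [MeasurableSpace Ω] {μ : Measure Ω} [IsProbabilityMeasure μ]
  {X : ℤ → Ω → ℝ} {B C L : ℝ} {p : ℕ}

/-- Outside the two exceptional sets the excess risk of the Gibbs estimator is controlled by that
of any parameter of any model. -/
theorem excess_risk_gibbsEstimator_le (hX : ∀ t, Measurable (X t))
    (hb : ∀ t ω, |X t ω| ≤ B) (hB : 0 < B) (hL : 0 < L) {θbar : Fin p → ℝ}
    {n k : ℕ} (hkn : k < n) {lam : ℝ} (hlam : 0 < lam) {ε : ℝ} (hε : 0 < ε)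
    {J : Finset (Fin p)} {θ₀ : Fin p → ℝ}
    (hθ₀ : θ₀ ∈ ThetaJ p L J) (ω : Ω)
    (h1 : ∫ θ, Real.exp (lam * (risk μ X θ - risk μ X θbar) / 2 -
      lam * (empRisk X n k θ ω - empRisk X n k θbar ω)) ∂(prior p L) ≤ 2 / ε)
    (h2 : lam * (empRisk X n k θ₀ ω - empRisk X n k θbar ω) ≤
      Real.log (2 / ε) + 3 / 2 * (lam * (risk μ X θ₀ - risk μ X θbar))) :
    lam * (risk μ X (gibbsEstimator p L X n k lam ω) - risk μ X θbar) ≤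
      3 * (lam * (risk μ X θ₀ - risk μ X θbar)) + 2 * (2 * Real.log (2 / ε) +
        lam * (4 * L * (1 + L) * B ^ 2 / (n - k)) - Real.log (weight p J) +
        J.card * Real.log (n - k)) := by
  have hN1 : (1 : ℝ) ≤ (n : ℝ) - k := by
    have : (k : ℝ) + 1 ≤ n := by exact_mod_cast hkn
    linarith
  have hN : (0 : ℝ) < (n : ℝ) - k := by linarith
  have hf : ConvexOn ℝ Set.univ fun θ : Fin p → ℝ =>
      lam * (risk μ X θ - risk μ X θbar) / 2 := by
    have h := ((convexOn_risk (μ := μ) (p := p) hX hb hB.le).add_const (-risk μ X θbar)).smul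
      (by positivity : 0 ≤ lam / 2)
    refine h.congr fun θ _ => ?_
    simp only [Pi.add_apply, smul_eq_mul]; ring
  have hK : ∀ θ ∈ Theta p L, lam * (risk μ X θ - risk μ X θbar) / 2 ≤
      lam * ((1 + L) * B) ^ 2 / 2 := fun θ hθ => by
    have r1 := risk_le (μ := μ) hX hb hB.le hθ
    have r2 := risk_nonneg (μ := μ) (X := X) θbar
    gcongr
    linarith
  have hJ := exp_mul_integral_le (X := X) hL hkn hlam ω hf hK (empRisk X n k θbar ω)
  have hZ := le_integral_exp_neg_empRisk hb hB.le hL hkn hlam ω hθ₀ (inv_pos.2 hN)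
    (inv_le_one_of_one_le₀ hN1) (empRisk X n k θbar ω)
  have hpos : (0 : ℝ) < 2 / ε := by positivity
  have h := ((mul_le_mul_of_nonneg_left hZ (Real.exp_pos _).le).trans hJ).trans h1
  have hlog := Real.log_le_log (by have := weight_pos (J := J); positivity) h
  have hw := weight_pos (J := J)
  rw [Real.log_mul (by positivity) (by positivity), Real.log_exp,
    Real.log_mul (by positivity) (by positivity), Real.log_exp,
    Real.log_mul (by positivity) (by positivity), Real.log_pow, Real.log_inv] at hlog
  rw [← div_eq_mul_inv] at hlog
  linarith

/-- The oracle inequality for one fixed model `J`. -/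
theorem le_measure_oracle_model (hX : ∀ t, Measurable (X t)) (hst : IsStationary μ X)
    (hb : ∀ t ω, |X t ω| ≤ B) (hB : 0 < B) (hL : 0 < L) (hmix : PhiMix μ X C)
    {θbar : Fin p → ℝ} (hθbar : θbar ∈ Theta p L)
    (hmin : ∀ θ : Fin p → ℝ, risk μ X θbar ≤ risk μ X θ) {n k : ℕ} (hp : 1 ≤ p) (hpk : p ≤ k)
    (hkn : k < n) {c₀ : ℝ} (hc : 128 * C * ((1 + L) * B) ^ 2 ≤ c₀) {ε : ℝ} (hε : 0 < ε)
    (hε1 : ε < 1) (J : Finset (Fin p)) :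
    ENNReal.ofReal (1 - ε) ≤
      μ {ω | risk μ X (gibbsEstimator p L X n k (((n : ℝ) - k) / (c₀ * k)) ω) ≤
        risk μ X θbar + 4 * (oracleRisk μ X L J - risk μ X θbar +
          (3 * c₀ + ((1 + L) * B) ^ 2) * k *
            (((J.card : ℝ) * Real.log (((n : ℝ) - k) * p / J.card) + Real.log (2 / ε)) /
              ((n : ℝ) - k)))} := by
  have hC := one_le_of_phiMix hmix
  have hb0 : 0 < ((1 + L) * B) ^ 2 := by positivity
  have hc0 : 0 < c₀ := lt_of_lt_of_le (by positivity) hc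
  have hk1 : (1 : ℝ) ≤ k := by exact_mod_cast hp.trans hpk
  have hk0 : (0 : ℝ) < k := by linarith
  have hN1 : (1 : ℝ) ≤ (n : ℝ) - k := by
    have : (k : ℝ) + 1 ≤ n := by exact_mod_cast hkn
    linarith
  have hN : (0 : ℝ) < (n : ℝ) - k := by linarith
  set lam := ((n : ℝ) - k) / (c₀ * k) with hlamdef
  have hlam : 0 < lam := by positivity
  set Q := (J.card : ℝ) * Real.log (((n : ℝ) - k) * p / J.card)
  have hQ : 0 ≤ Q := card_mul_log_nonneg hN1
  have hl2 : Real.log 2 ≤ Real.log (2 / ε) := by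
    refine Real.log_le_log two_pos ?_
    rw [le_div_iff₀ hε]; linarith
  have h2 := Real.log_two_gt_d9
  set ℓ := Real.log (2 / ε)
  have hℓ : 1 / 2 ≤ ℓ := by linarith
  have hne : Nonempty (ThetaJ p L J) := (nonempty_thetaJ hL).to_subtype
  have hO : risk μ X θbar ≤ oracleRisk μ X L J := le_ciInf fun θ => hmin θ
  rcases (Nat.succ_le_of_lt hkn).eq_or_lt with hn | hn
  · -- With a single residual the bound exceeds the largest possible excess risk.
    have hN1' : (n : ℝ) - k = 1 := by
      have : (n : ℝ) = k + 1 := by exact_mod_cast hn.symm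
      linarith
    have huniv : {ω | risk μ X (gibbsEstimator p L X n k lam ω) ≤ risk μ X θbar +
        4 * (oracleRisk μ X L J - risk μ X θbar +
          (3 * c₀ + ((1 + L) * B) ^ 2) * k * ((Q + ℓ) / ((n : ℝ) - k)))} = Set.univ := by
      refine Set.eq_univ_of_forall fun ω => ?_
      rw [Set.mem_ofPred_eq]
      have r1 := risk_le (μ := μ) hX hb hB.le
        (gibbsEstimator_mem_theta (X := X) (p := p) hL hkn hlam ω)
      have r2 := risk_nonneg (μ := μ) (X := X) θbar
      rw [hN1', div_one]
      have r3 : ((1 + L) * B) ^ 2 * 1 * (1 / 2) ≤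
          (3 * c₀ + ((1 + L) * B) ^ 2) * k * (Q + ℓ) := by
        gcongr <;> linarith
      linarith
    rw [huniv, measure_univ]
    exact ENNReal.ofReal_le_one.2 (by linarith)
  have hN2 : (2 : ℝ) ≤ (n : ℝ) - k := by
    have : (k : ℝ) + 2 ≤ n := by exact_mod_cast hn
    linarith
  -- A parameter of the model that is optimal up to a fraction of the remainder term.
  obtain ⟨⟨θ₀, hθ₀⟩, hnear⟩ := exists_lt_of_ciInf_lt
    (show (⨅ θ : ThetaJ p L J, risk μ X (θ : Fin p → ℝ)) < oracleRisk μ X L J + ℓ / lam from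
      lt_add_of_pos_right _ (by positivity))
  change risk μ X θ₀ < _ at hnear
  have m1 := measure_integral_exp_ge_le hX hst hb hB hL hmix hθbar hmin hp hpk hkn hc hε
  have m2 := measure_exp_empRisk_ge_le hX hst hb hB hL hmix hθ₀.1 hθbar hmin hp hpk hkn hc hε
  set bad₁ := {ω | 2 / ε < ∫ θ, Real.exp (lam * (risk μ X θ - risk μ X θbar) / 2 -
      lam * (empRisk X n k θ ω - empRisk X n k θbar ω)) ∂(prior p L)} with hbad₁
  set bad₂ := {ω | ℓ + 3 / 2 * (lam * (risk μ X θ₀ - risk μ X θbar)) <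
      lam * (empRisk X n k θ₀ ω - empRisk X n k θbar ω)} with hbad₂
  set good := {ω | risk μ X (gibbsEstimator p L X n k lam ω) ≤ risk μ X θbar +
        4 * (oracleRisk μ X L J - risk μ X θbar +
          (3 * c₀ + ((1 + L) * B) ^ 2) * k * ((Q + ℓ) / ((n : ℝ) - k)))} with hgood
  have hcover : (Set.univ : Set Ω) ⊆ good ∪ (bad₁ ∪ bad₂) := by
    intro ω _
    by_cases hω : ω ∈ bad₁ ∪ bad₂
    · exact Or.inr hω
    have hω1 : ω ∉ bad₁ := fun h => hω (Or.inl h)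
    have hω2 : ω ∉ bad₂ := fun h => hω (Or.inr h)
    have h := excess_risk_gibbsEstimator_le hX hb hB hL hkn hlam hε hθ₀ ω
      (not_lt.1 hω1) (not_lt.1 hω2)
    refine Or.inl ?_
    rw [hgood, Set.mem_ofPred_eq]
    have hpen := neg_log_weight_add_le (J := J) hN2
    have hκ : lam * (4 * L * (1 + L) * B ^ 2 / ((n : ℝ) - k)) ≤ 1 / 32 := by
      have e : lam * (4 * L * (1 + L) * B ^ 2 / ((n : ℝ) - k)) =
          4 * L * (1 + L) * B ^ 2 / (c₀ * k) := by rw [hlamdef]; field_simp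
      rw [e, div_le_div_iff₀ (by positivity) (by norm_num)]
      have h3 : L * (1 + L) * B ^ 2 ≤ ((1 + L) * B) ^ 2 := by
        nlinarith [sq_nonneg B, sq_nonneg (L * B)]
      have h4 : 128 * ((1 + L) * B) ^ 2 ≤ c₀ := by nlinarith
      have h5 : c₀ ≤ c₀ * k := by nlinarith
      linarith
    have hslack : lam * (risk μ X θ₀ - risk μ X θbar) ≤
        lam * (oracleRisk μ X L J - risk μ X θbar) + ℓ := by
      have h3 : risk μ X θ₀ - risk μ X θbar ≤
          (oracleRisk μ X L J - risk μ X θbar) + ℓ / lam := by linarith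
      have h4 := mul_le_mul_of_nonneg_left h3 hlam.le
      rwa [mul_add, mul_div_cancel₀ ℓ hlam.ne'] at h4
    have hO' : 0 ≤ lam * (oracleRisk μ X L J - risk μ X θbar) :=
      mul_nonneg hlam.le (sub_nonneg.2 hO)
    have hcst : 3 * (Q + ℓ) ≤
        lam * ((3 * c₀ + ((1 + L) * B) ^ 2) * k * ((Q + ℓ) / ((n : ℝ) - k))) := by
      have e : lam * ((3 * c₀ + ((1 + L) * B) ^ 2) * k * ((Q + ℓ) / ((n : ℝ) - k))) =
          3 * (Q + ℓ) + ((1 + L) * B) ^ 2 / c₀ * (Q + ℓ) := by rw [hlamdef]; field_simp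
      have h3 : 0 ≤ ((1 + L) * B) ^ 2 / c₀ * (Q + ℓ) := by positivity
      linarith
    have hfin : lam * (risk μ X (gibbsEstimator p L X n k lam ω) - risk μ X θbar) ≤
        lam * (4 * (oracleRisk μ X L J - risk μ X θbar +
          (3 * c₀ + ((1 + L) * B) ^ 2) * k * ((Q + ℓ) / ((n : ℝ) - k)))) := by
      linarith
    linarith [le_of_mul_le_mul_left hfin hlam]
  have hsum : 1 ≤ μ good + ENNReal.ofReal ε := by
    calc (1 : ENNReal) = μ Set.univ := measure_univ.symm
      _ ≤ μ (good ∪ (bad₁ ∪ bad₂)) := measure_mono hcover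
      _ ≤ μ good + (μ bad₁ + μ bad₂) :=
          (measure_union_le _ _).trans (add_le_add_right (measure_union_le _ _) _)
      _ ≤ μ good + (ENNReal.ofReal (ε / 2) + ENNReal.ofReal (ε / 2)) := by gcongr
      _ = μ good + ENNReal.ofReal ε := by
          rw [← ENNReal.ofReal_add (by positivity) (by positivity), add_halves]
  rw [ENNReal.ofReal_sub 1 hε.le, ENNReal.ofReal_one]
  exact tsub_le_iff_right.2 hsum

theorem le_measure_oracle_of_bounded (hX : ∀ t, Measurable (X t)) (hst : IsStationary μ X)
    (hb : ∀ t ω, |X t ω| ≤ B) (hB : 0 < B) (hL : 0 < L) (hmix : PhiMix μ X C)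
    {θbar : Fin p → ℝ} (hθbar : θbar ∈ Theta p L)
    (hmin : ∀ θ : Fin p → ℝ, risk μ X θbar ≤ risk μ X θ) {n k : ℕ} (hp : 1 ≤ p) (hpk : p ≤ k)
    (hkn : k < n) {c₀ : ℝ} (hc : 128 * C * ((1 + L) * B) ^ 2 ≤ c₀) {ε : ℝ} (hε : 0 < ε) :
    ENNReal.ofReal (1 - ε) ≤
      μ {ω | risk μ X (gibbsEstimator p L X n k (((n : ℝ) - k) / (c₀ * k)) ω) ≤
        risk μ X θbar + 4 * ⨅ J : Finset (Fin p), (oracleRisk μ X L J - risk μ X θbar +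
          (3 * c₀ + ((1 + L) * B) ^ 2) * k *
            (((J.card : ℝ) * Real.log (((n : ℝ) - k) * p / J.card) + Real.log (2 / ε)) /
              ((n : ℝ) - k)))} := by
  rcases le_or_gt 1 ε with hε1 | hε1
  · rw [ENNReal.ofReal_of_nonpos (by linarith)]; exact zero_le
  -- There are finitely many models, so the infimum is attained at a deterministic one.
  obtain ⟨J, hJ⟩ := exists_eq_ciInf_of_finite (f := fun J : Finset (Fin p) =>
    oracleRisk μ X L J - risk μ X θbar + (3 * c₀ + ((1 + L) * B) ^ 2) * k *
      (((J.card : ℝ) * Real.log (((n : ℝ) - k) * p / J.card) + Real.log (2 / ε)) / ((n : ℝ) - k)))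
  rw [← hJ]
  exact le_measure_oracle_model hX hst hb hB hL hmix hθbar hmin hp hpk hkn hc hε hε1 J

end Bounded

/-! ### Truncation of an almost surely bounded process -/

section Clip

variable {Ω : Type*} {X : ℤ → Ω → ℝ} {B C L : ℝ} {p : ℕ}

/-- The process truncated to the interval `[-B, B]`. -/
noncomputable def clip (B : ℝ) (X : ℤ → Ω → ℝ) (t : ℤ) (ω : Ω) : ℝ := max (-B) (min B (X t ω))

theorem abs_clip_le (hB : 0 ≤ B) (t : ℤ) (ω : Ω) : |clip B X t ω| ≤ B :=
  abs_le.2 ⟨le_max_left _ _, max_le (by linarith) (min_le_left _ _)⟩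

theorem clip_eq {t : ℤ} {ω : Ω} (h : |X t ω| ≤ B) : clip B X t ω = X t ω := by
  rw [clip, min_eq_right (abs_le.1 h).2, max_eq_right (abs_le.1 h).1]

theorem measurable_clip_real : Measurable fun x : ℝ => max (-B) (min B x) :=
  measurable_const.max (measurable_const.min measurable_id)

/-- Predictions at a sample point depend only on the path of the process there. -/
theorem predictor_congr {Y : ℤ → Ω → ℝ} {ω : Ω} (h : ∀ t, X t ω = Y t ω) (θ : Fin p → ℝ) (t : ℤ) :
    predictor X θ t ω = predictor Y θ t ω := by
  simp only [predictor, h]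

theorem gibbsEstimator_congr {Y : ℤ → Ω → ℝ} {ω : Ω} (h : ∀ t, X t ω = Y t ω) (n k : ℕ)
    (lam : ℝ) : gibbsEstimator p L X n k lam ω = gibbsEstimator p L Y n k lam ω := by
  have : ∀ θ : Fin p → ℝ, empRisk X n k θ ω = empRisk Y n k θ ω := fun θ => by
    simp only [empRisk, predictor_congr h, h]
  simp only [gibbsEstimator, gibbsMeasure, this]

variable [MeasurableSpace Ω] {μ : Measure Ω}

theorem risk_congr {Y : ℤ → Ω → ℝ} (h : ∀ᵐ ω ∂μ, ∀ t, X t ω = Y t ω) (θ : Fin p → ℝ) :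
    risk μ X θ = risk μ Y θ := by
  refine integral_congr_ae ?_
  filter_upwards [h] with ω hω
  simp only [predictor_congr hω, hω]

theorem measurable_clip (hX : ∀ t, Measurable (X t)) (t : ℤ) : Measurable (clip B X t) :=
  measurable_clip_real.comp (hX t)

theorem isStationary_clip (hst : IsStationary μ X) : IsStationary μ (clip B X) := fun h =>
  (hst h).comp (u := fun (x : ℤ → ℝ) t => max (-B) (min B (x t)))
    (measurable_pi_lambda _ fun t => measurable_clip_real.comp (measurable_pi_apply t))

theorem ae_clip_eq (hst : IsStationary μ X) (hbd : Bound μ X B) :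
    ∀ᵐ ω ∂μ, ∀ t, clip B X t ω = X t ω := by
  rw [ae_all_iff]
  intro t
  have hid : IdentDistrib (fun ω => X (0 + t) ω) (fun ω => X 0 ω) μ μ :=
    (hst t).comp (u := fun x : ℤ → ℝ => x 0) (measurable_pi_apply 0)
  have h := hid.symm.ae_snd (p := fun x => |x| ≤ B)
    (measurableSet_le measurable_id.abs measurable_const) hbd
  filter_upwards [h] with ω hω
  rw [zero_add] at hω
  exact clip_eq hω

variable [IsProbabilityMeasure μ]

theorem phiCoeff_clip_le (r : ℕ) : phiCoeff μ (clip B X) r ≤ phiCoeff μ X r := by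
  have hle : ∀ S : Set ℤ, (⨆ t ∈ S, MeasurableSpace.comap (clip B X t) inferInstance) ≤
      ⨆ t ∈ S, MeasurableSpace.comap (X t) inferInstance := fun S => by
    refine iSup₂_mono fun t _ => ?_
    rintro _ ⟨s, hs, rfl⟩
    exact ⟨_, measurable_clip_real (B := B) hs, rfl⟩
  refine csSup_le_csSup (bddAbove_phiCoeff_set r) ⟨_, Set.univ, Set.univ, MeasurableSet.univ,
    MeasurableSet.univ, by simp, rfl⟩ ?_
  rintro x ⟨A, F, hA, hF, h0, rfl⟩
  exact ⟨A, F, hle _ A hA, hle _ F hF, h0, rfl⟩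

theorem phiMix_clip (hmix : PhiMix μ X C) : PhiMix μ (clip B X) C := by
  have hle : ∀ r : ℕ, √(phiCoeff μ (clip B X) (r + 1)) ≤ √(phiCoeff μ X (r + 1)) := fun r =>
    Real.sqrt_le_sqrt (phiCoeff_clip_le _)
  have hs := Summable.of_nonneg_of_le (fun r => Real.sqrt_nonneg _) hle hmix.1
  exact ⟨hs, (add_le_add_right (hs.tsum_le_tsum hle hmix.1) 1).trans hmix.2⟩

end Clip

end SparseAR

open SparseAR in
theorem mainTheorem3 (B C L : ℝ) (hB : 0 < B) (hC : 0 < C) (hL : 0 < L) :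
    ∃ cmin > (0 : ℝ), ∀ c₀ ≥ cmin, ∃ cst > (0 : ℝ),
      ∀ (p k n : ℕ), 1 ≤ p → p ≤ k → k < n →
      ∀ (Ω : Type*) [MeasurableSpace Ω] (μ : Measure Ω) [IsProbabilityMeasure μ]
        (X : ℤ → Ω → ℝ), (∀ t, Measurable (X t)) →
        SparseAR.IsStationary μ X → SparseAR.Bound μ X B → SparseAR.PhiMix μ X C →
      ∀ θbar ∈ SparseAR.Theta p L,
        (∀ θ : Fin p → ℝ, SparseAR.risk μ X θbar ≤ SparseAR.risk μ X θ) →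
      ∀ ε > (0 : ℝ),
        ENNReal.ofReal (1 - ε) ≤
          μ {ω | SparseAR.risk μ X
                (SparseAR.gibbsEstimator p L X n k (((n : ℝ) - k) / (c₀ * k)) ω) ≤
              SparseAR.risk μ X θbar +
                4 * ⨅ J : Finset (Fin p),
                  (SparseAR.oracleRisk μ X L J - SparseAR.risk μ X θbar +
                    cst * k *
                      (((J.card : ℝ) * Real.log (((n : ℝ) - k) * p / J.card) +
                        Real.log (2 / ε)) / ((n : ℝ) - k)))} := by
  refine ⟨128 * C * ((1 + L) * B) ^ 2, by positivity, fun c₀ hc => ?_⟩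
  have hc0 : 0 < c₀ := lt_of_lt_of_le (by positivity) hc
  refine ⟨3 * c₀ + ((1 + L) * B) ^ 2, by positivity, ?_⟩
  intro p k n hp hpk hkn Ω _ μ _ X hX hst hbd hmix θbar hθbar hmin ε hε
  have hae := ae_clip_eq hst hbd
  have hrisk : ∀ θ : Fin p → ℝ, risk μ (clip B X) θ = risk μ X θ := risk_congr hae
  have horacle : ∀ J : Finset (Fin p), oracleRisk μ (clip B X) L J = oracleRisk μ X L J :=
    fun J => by simp only [oracleRisk, hrisk]
  have h := le_measure_oracle_of_bounded (measurable_clip hX) (isStationary_clip hst)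
    (abs_clip_le hB.le) hB hL (phiMix_clip hmix) hθbar
    (fun θ => by rw [hrisk, hrisk]; exact hmin θ) hp hpk hkn hc hε
  refine h.trans (measure_mono_ae ?_)
  filter_upwards [hae] with ω hω hmem
  change (_ : ℝ) ≤ _ at hmem
  change (_ : ℝ) ≤ _
  simp only [hrisk, horacle, gibbsEstimator_congr hω] at hmem
  exact hmem
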